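/- Let $(M^m,g)$ be a connected smooth Riemannian manifold, $(N^n,h)$ a smooth Riemannian manifold (both without boundary), and $\varphi:M\to N$ a smooth isometric immersion, $\varphi^*h=g$. Let $B(X,Y)$ be its second fundamental form (the normal component of $\nabla^N_X d\varphi(Y)$), $\eta=\frac1m\,\mathrm{Trace}_g B$ its mean curvature vector field and, for a normal field $\xi$, let $A_\xi$ be the shape operator, where $-d\varphi(A_\xi X)$ is the tangential component of $\nabla^{N}_X\xi$. Let $\tau(\varphi)=\mathrm{Trace}_g\nabla d\varphi$ be the tension field and $$\tau_2(\varphi)=\mathrm{Trace}_g(\nabla^\varphi\nabla^\varphi-\nabla^\varphi_{\nabla^M})\tau(\varphi)-\mathrm{Trace}_g R^N(d\varphi,\tau(\varphi))d\varphi$$ the bitension field, where $\nabla^\varphi$ is the connection on vector fields along $\varphi$ induced by the Levi-Civita connection $\nabla^N$ and $R^N(X,Y)Z=[\nabla^N_X,\nabla^N_Y]Z-\nabla^N_{[X,Y]}Z$. Suppose that $\varphi$ is pseudo-umbilical, i.e. $A_\eta(X)=\langle\eta,\eta\rangle X$ for every tangent vector $X$, and proper biharmonic, i.e. $\tau_2(\varphi)=0$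 on $M$ and $\varphi$ is not minimal ($\eta$ does not vanish identically). Suppose further that $\varphi$ is $f$-biharmonic for a smooth function $f:M\to(0,\infty)$, i.e. $$\tau_{2,f}(\varphi)=f\,\tau_2(\varphi)+(\Delta f)\,\tau(\varphi)+2\nabla^\varphi_{\mathrm{grad} f}\tau(\varphi)=0\quad\text{on }M .$$ Then $f$ is constant on $M$. -/

import Mathlib

open scoped Manifold ContDiff

noncomputable section

namespace FBiharm

/-- The coordinate space `ℝᵏ`. -/
abbrev Coord (k : ℕ) : Type := EuclideanSpace ℝ (Fin k)

/-- A smooth Riemannian metric on a smooth `k`-dimensional manifold. -/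
abbrev RMetric (k : ℕ) (M : Type*) [TopologicalSpace M] [ChartedSpace (Coord k) M]
    [IsManifold (𝓡 k) ∞ M] : Type _ :=
  Bundle.ContMDiffRiemannianMetric (𝓡 k) ∞ (Coord k) (fun p : M => TangentSpace (𝓡 k) p)

/-! ### Riemannian geometry in coordinates

Below, `G x` and `H y` are metrics on open sets of `ℝᵐ` and `ℝⁿ` (bilinear forms depending on the
point) and `φ` is a map from the first open set to the second. -/

section Coordinates

variable {m n : ℕ}

/-- The coordinate vector `∂ᵢ`. -/
def coordVec (i : Fin m) : Coord m := EuclideanSpace.single i 1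

/-- The inverse matrix `g^{ij}` of the matrix `g_{ij} = G(∂ᵢ, ∂ⱼ)` of the metric at `x`. -/
def inverseMetric (G : Coord m → Coord m →L[ℝ] Coord m →L[ℝ] ℝ) (x : Coord m) :
    Matrix (Fin m) (Fin m) ℝ :=
  (Matrix.of fun i j => G x (coordVec i) (coordVec j))⁻¹

/-- The metric trace `∑ g^{ij} T(∂ᵢ, ∂ⱼ)` of a bilinear expression `T` at `x`. -/
def metricTrace {W : Type*} [AddCommGroup W] [Module ℝ W]
    (G : Coord m → Coord m →L[ℝ] Coord m →L[ℝ] ℝ) (x : Coord m)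
    (T : Coord m → Coord m → W) : W :=
  ∑ i, ∑ j, inverseMetric G x i j • T (coordVec i) (coordVec j)

/-- The Christoffel map of the Levi-Civita connection:
`Γ(v, w)^k = ∑ₗ g^{kl} · ½ (∂_v G(w, ∂ₗ) + ∂_w G(v, ∂ₗ) - ∂ₗ G(v, w))`. -/
def christoffel (G : Coord m → Coord m →L[ℝ] Coord m →L[ℝ] ℝ) (x v w : Coord m) : Coord m :=
  ∑ k, (∑ l, inverseMetric G x k l *
    ((1 / 2 : ℝ) * (fderiv ℝ G x v w (coordVec l) + fderiv ℝ G x w v (coordVec l)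
      - fderiv ℝ G x (coordVec l) v w))) • coordVec k

/-- The curvature operator `R(u, v)w = ∇ᵤ∇ᵥw - ∇ᵥ∇ᵤw - ∇_{[u,v]}w` at `y`, computed with the
constant (hence commuting) coordinate fields `u`, `v`, `w`, for which `∇ᵥw = Γ(v, w)`. -/
def curvature (H : Coord n → Coord n →L[ℝ] Coord n →L[ℝ] ℝ) (y u v w : Coord n) : Coord n :=
  (fderiv ℝ (fun z => christoffel H z v w) y u + christoffel H y u (christoffel H y v w))
    - (fderiv ℝ (fun z => christoffel H z u w) y v + christoffel H y v (christoffel H y u w))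

/-- The gradient `(grad f)^i = ∑ⱼ g^{ij} ∂ⱼf`. -/
def gradient (G : Coord m → Coord m →L[ℝ] Coord m →L[ℝ] ℝ) (f : Coord m → ℝ) (x : Coord m) :
    Coord m :=
  ∑ i, (∑ j, inverseMetric G x i j * fderiv ℝ f x (coordVec j)) • coordVec i

/-- The Laplace-Beltrami operator `Δf`, the trace of the Hessian
`(∇df)(v, w) = ∂_v(df(w)) - df(∇ᵥw)`. -/
def laplacian (G : Coord m → Coord m →L[ℝ] Coord m →L[ℝ] ℝ) (f : Coord m → ℝ) (x : Coord m) :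
    ℝ :=
  metricTrace G x fun v w =>
    fderiv ℝ (fun z => fderiv ℝ f z w) x v - fderiv ℝ f x (christoffel G x v w)

/-- The connection `∇^φ` on vector fields along `φ` induced by the Levi-Civita connection of `H`:
`∇^φ_v V = ∂_v V + Γ(dφ v, V)`. -/
def covAlong (H : Coord n → Coord n →L[ℝ] Coord n →L[ℝ] ℝ) (φ : Coord m → Coord n)
    (V : Coord m → Coord n) (x v : Coord m) : Coord n :=
  fderiv ℝ V x v + christoffel H (φ x) (fderiv ℝ φ x v) (V x)

/-- The tension field `τ(φ) = Trace_g ∇dφ`, where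
`(∇dφ)(v, w) = ∇^φ_v (dφ w) - dφ(∇^M_v w)`. -/
def tension (G : Coord m → Coord m →L[ℝ] Coord m →L[ℝ] ℝ)
    (H : Coord n → Coord n →L[ℝ] Coord n →L[ℝ] ℝ) (φ : Coord m → Coord n) (x : Coord m) :
    Coord n :=
  metricTrace G x fun v w =>
    covAlong H φ (fun z => fderiv ℝ φ z w) x v - fderiv ℝ φ x (christoffel G x v w)

/-- `Trace_g (∇^φ ∇^φ - ∇^φ_{∇^M}) V` for a vector field `V` along `φ`. -/
def roughLaplacian (G : Coord m → Coord m →L[ℝ] Coord m →L[ℝ] ℝ)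
    (H : Coord n → Coord n →L[ℝ] Coord n →L[ℝ] ℝ) (φ : Coord m → Coord n)
    (V : Coord m → Coord n) (x : Coord m) : Coord n :=
  metricTrace G x fun v w =>
    covAlong H φ (fun z => covAlong H φ V z w) x v - covAlong H φ V x (christoffel G x v w)

/-- The bitension field
`τ₂(φ) = Trace_g (∇^φ ∇^φ - ∇^φ_{∇^M}) τ(φ) - Trace_g R^N(dφ, τ(φ)) dφ`. -/
def bitension (G : Coord m → Coord m →L[ℝ] Coord m →L[ℝ] ℝ)
    (H : Coord n → Coord n →L[ℝ] Coord n →L[ℝ] ℝ) (φ : Coord m → Coord n) (x : Coord m) :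
    Coord n :=
  roughLaplacian G H φ (tension G H φ) x
    - metricTrace G x fun v w =>
        curvature H (φ x) (fderiv ℝ φ x v) (tension G H φ x) (fderiv ℝ φ x w)

/-- The `f`-bitension field `τ_{2,f}(φ) = f τ₂(φ) + (Δf) τ(φ) + 2 ∇^φ_{grad f} τ(φ)`. -/
def fBitension (G : Coord m → Coord m →L[ℝ] Coord m →L[ℝ] ℝ)
    (H : Coord n → Coord n →L[ℝ] Coord n →L[ℝ] ℝ) (φ : Coord m → Coord n) (f : Coord m → ℝ)
    (x : Coord m) : Coord n :=
  f x • bitension G H φ x + laplacian G f x • tension G H φ x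
    + (2 : ℝ) • covAlong H φ (tension G H φ) x (gradient G f x)

/-- For an isometric immersion `φ`, the tangent vector `Z` such that `dφ Z` is the tangential part
of the vector `W` at `φ x`, i.e. `Z^i = ∑ⱼ g^{ij} H(W, dφ ∂ⱼ)`. -/
def tangentPart (G : Coord m → Coord m →L[ℝ] Coord m →L[ℝ] ℝ)
    (H : Coord n → Coord n →L[ℝ] Coord n →L[ℝ] ℝ) (φ : Coord m → Coord n) (x : Coord m)
    (W : Coord n) : Coord m :=
  ∑ i, (∑ j, inverseMetric G x i j * H (φ x) W (fderiv ℝ φ x (coordVec j))) • coordVec i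

/-- The second fundamental form of an isometric immersion: `B(v, w)` is the normal part of
`∇^N_v (dφ w)`. -/
def secondFundForm (G : Coord m → Coord m →L[ℝ] Coord m →L[ℝ] ℝ)
    (H : Coord n → Coord n →L[ℝ] Coord n →L[ℝ] ℝ) (φ : Coord m → Coord n)
    (x v w : Coord m) : Coord n :=
  covAlong H φ (fun z => fderiv ℝ φ z w) x v
    - fderiv ℝ φ x (tangentPart G H φ x (covAlong H φ (fun z => fderiv ℝ φ z w) x v))

/-- The mean curvature vector field `η = (1/m) Trace_g B`. -/
def meanCurvature (G : Coord m → Coord m →L[ℝ] Coord m →L[ℝ] ℝ)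
    (H : Coord n → Coord n →L[ℝ] Coord n →L[ℝ] ℝ) (φ : Coord m → Coord n) (x : Coord m) :
    Coord n :=
  (1 / m : ℝ) • metricTrace G x fun v w => secondFundForm G H φ x v w

/-- The shape operator `A_ξ` with respect to the normal field `ξ`: by Weingarten's formula
`∇^N_v ξ = -dφ(A_ξ v) + ∇^⊥_v ξ`, so `A_ξ v` is minus the tangential part of `∇^N_v ξ`. -/
def shapeOperator (G : Coord m → Coord m →L[ℝ] Coord m →L[ℝ] ℝ)
    (H : Coord n → Coord n →L[ℝ] Coord n →L[ℝ] ℝ) (φ : Coord m → Coord n)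
    (ξ : Coord m → Coord n) (x v : Coord m) : Coord m :=
  -tangentPart G H φ x (covAlong H φ ξ x v)

end Coordinates

/-! ### The notions on manifolds -/

section Manifolds

variable {m n : ℕ}
  {M : Type*} [TopologicalSpace M] [ChartedSpace (Coord m) M] [IsManifold (𝓡 m) ∞ M]
  {N : Type*} [TopologicalSpace N] [ChartedSpace (Coord n) N] [IsManifold (𝓡 n) ∞ N]

/-- The coordinate expression of a Riemannian metric in a chart `c`, i.e. its pullback under
the parametrization `c.symm`. -/
def metricInChart (g : RMetric m M) (c : OpenPartialHomeomorph M (Coord m)) (x : Coord m) :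
    Coord m →L[ℝ] Coord m →L[ℝ] ℝ :=
  let T : Coord m →L[ℝ] Coord m := mfderiv (𝓡 m) (𝓡 m) c.symm x
  let B : Coord m →L[ℝ] Coord m →L[ℝ] ℝ := g.inner (c.symm x)
  B.bilinearComp T T

theorem metricInChart_apply (g : RMetric m M) (c : OpenPartialHomeomorph M (Coord m))
    (x v w : Coord m) :
    metricInChart g c x v w =
      g.inner (c.symm x) (mfderiv (𝓡 m) (𝓡 m) c.symm x v) (mfderiv (𝓡 m) (𝓡 m) c.symm x w) :=
  rfl

/-- The relation `P` between the chart of `M`, the coordinate expressions of `g`, `h`, `φ` and the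
point holds at all points of all pairs of smooth charts `c` of `M` and `d` of `N`. It is used only
for relations that do not depend on the choice of coordinates. -/
def InAllCharts (g : RMetric m M) (h : RMetric n N) (φ : M → N)
    (P : OpenPartialHomeomorph M (Coord m) →
      (Coord m → Coord m →L[ℝ] Coord m →L[ℝ] ℝ) → (Coord n → Coord n →L[ℝ] Coord n →L[ℝ] ℝ) →
      (Coord m → Coord n) → Coord m → Prop) : Prop :=
  ∀ c ∈ IsManifold.maximalAtlas (𝓡 m) ∞ M, ∀ d ∈ IsManifold.maximalAtlas (𝓡 n) ∞ N,
    ∀ x ∈ c.target, φ (c.symm x) ∈ d.source →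
      P c (metricInChart g c) (metricInChart h d) (fun z => d (φ (c.symm z))) x

/-- `φ : (M, g) → (N, h)` is a smooth isometric immersion, `φ^*h = g`. -/
structure IsIsometricImmersion (g : RMetric m M) (h : RMetric n N) (φ : M → N) : Prop where
  smooth : ContMDiff (𝓡 m) (𝓡 n) ∞ φ
  isometric : ∀ (p : M) (v w : TangentSpace (𝓡 m) p),
    h.inner (φ p) (mfderiv (𝓡 m) (𝓡 n) φ p v) (mfderiv (𝓡 m) (𝓡 n) φ p w) = g.inner p v w

/-- The submanifold is minimal: `η = 0`. -/
def IsMinimal (g : RMetric m M) (h : RMetric n N) (φ : M → N) : Prop :=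
  InAllCharts g h φ fun _ G H φ' x => meanCurvature G H φ' x = 0

/-- The submanifold is pseudo-umbilical: `A_η(X) = ⟨η, η⟩ X` for all tangent vectors `X`. -/
def IsPseudoUmbilical (g : RMetric m M) (h : RMetric n N) (φ : M → N) : Prop :=
  InAllCharts g h φ fun _ G H φ' x => ∀ v : Coord m,
    shapeOperator G H φ' (meanCurvature G H φ') x v
      = H (φ' x) (meanCurvature G H φ' x) (meanCurvature G H φ' x) • v

/-- `φ` is biharmonic: `τ₂(φ) = 0`. -/
def IsBiharmonic (g : RMetric m M) (h : RMetric n N) (φ : M → N) : Prop :=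
  InAllCharts g h φ fun _ G H φ' x => bitension G H φ' x = 0

/-- `φ` is `f`-biharmonic for the function `f`: `f` is smooth and positive and
`τ_{2,f}(φ) = 0`. -/
structure IsFBiharmonic (g : RMetric m M) (h : RMetric n N) (φ : M → N) (f : M → ℝ) :
    Prop where
  smooth : ContMDiff (𝓡 m) 𝓘(ℝ, ℝ) ∞ f
  pos : ∀ p, 0 < f p
  equation : InAllCharts g h φ fun c G H φ' x =>
    fBitension G H φ' (fun z => f (c.symm z)) x = 0

end Manifolds

end FBiharm

end

/-! Since `τ₂ = 0`, the `f`-biharmonic equation reduces to `(Δf) τ + 2 ∇_{grad f} τ = 0`. For an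
isometric immersion `τ = mη` is normal, so the tangential part of this equation is `A_η(grad f) = 0`
up to a constant factor, and pseudo-umbilicity turns it into `|η|² grad f = 0`. Hence at every point
`df = 0` or `τ = 0` (`IsometricOn.fderiv_eq_zero_or_tension_eq_zero`).

If `df ≠ 0` at one point, then `df ≠ 0` nearby and `τ` vanishes on a nonempty open set. What remains
is unique continuation: `τ` would then vanish on all of `M`, making `φ` minimal. In coordinates `τ₂
= 0` is a linear second order system for `τ` with scalar principal part `g^{ij} ∂ᵢ∂ⱼ`, so it yields
`|g^{ij} ∂ᵢ∂ⱼ τ| ≤ C (|τ| + |∂τ|)` on compact sets (`IsometricOn.exists_bound_of_biharmonic`). The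
coefficients are only smooth, so analyticity is not available, and unique continuation is proved
through a Carleman estimate (`carleman_estimate`). Its weight is `exp(tψ)` with `ψ = exp(-l |x -
q|²)`, convexified by a large `l` (`exists_carleman_weight`). Because the principal part is scalar,
the estimate applies to each component of `τ` separately and the coupling is absorbed as a lower
order term. Consequently a solution vanishing near the centre of a ball vanishes throughout it
(`eq_zero_of_elliptic_inequality`).

The condition `τ = 0` at a point does not depend on the charts (`IsometricOn.fderiv_tension`), since
transition maps are isometries between coordinate metrics. The interior of the zero set of `τ` is
therefore well defined on `M`, and by unique continuation it is clopen
(`isClopen_interior_tensionZeroSet`). Connectedness of `M` finishes the argument. -/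

set_option maxSynthPendingDepth 3

noncomputable section

namespace FBiharm

/-! ### Partial derivatives of smooth real functions. -/

section Calculus

open MeasureTheory

variable {m : ℕ}

/-- The partial derivative `∂ᵢ f`. -/
def pd (i : Fin m) (f : Coord m → ℝ) (x : Coord m) : ℝ := fderiv ℝ f x (coordVec i)

@[fun_prop]
theorem contDiff_pd (i : Fin m) {f : Coord m → ℝ} (hf : ContDiff ℝ ∞ f) :
    ContDiff ℝ ∞ (pd i f) :=
  (hf.fderiv_right (m := ∞) (by simp)).clm_apply contDiff_const

theorem differentiableAt_of_smooth {f : Coord m → ℝ} (hf : ContDiff ℝ ∞ f) (x : Coord m) :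
    DifferentiableAt ℝ f x :=
  hf.differentiable (by simp) x

theorem pd_add (i : Fin m) {f g : Coord m → ℝ} (hf : ContDiff ℝ ∞ f) (hg : ContDiff ℝ ∞ g)
    (x : Coord m) : pd i (fun z => f z + g z) x = pd i f x + pd i g x := by
  simp only [pd]
  rw [fderiv_fun_add (differentiableAt_of_smooth hf x) (differentiableAt_of_smooth hg x)]
  rfl

theorem pd_sub (i : Fin m) {f g : Coord m → ℝ} (hf : ContDiff ℝ ∞ f) (hg : ContDiff ℝ ∞ g)
    (x : Coord m) : pd i (fun z => f z - g z) x = pd i f x - pd i g x := by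
  simp only [pd]
  rw [fderiv_fun_sub (differentiableAt_of_smooth hf x) (differentiableAt_of_smooth hg x)]
  rfl

theorem pd_mul (i : Fin m) {f g : Coord m → ℝ} (hf : ContDiff ℝ ∞ f) (hg : ContDiff ℝ ∞ g)
    (x : Coord m) : pd i (fun z => f z * g z) x = f x * pd i g x + pd i f x * g x := by
  simp only [pd]
  rw [fderiv_fun_mul (differentiableAt_of_smooth hf x) (differentiableAt_of_smooth hg x)]
  simp [mul_comm]

theorem pd_sum {ι : Type*} (s : Finset ι) (i : Fin m) {f : ι → Coord m → ℝ}
    (hf : ∀ k, ContDiff ℝ ∞ (f k)) (x : Coord m) :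
    pd i (fun z => ∑ k ∈ s, f k z) x = ∑ k ∈ s, pd i (f k) x := by
  simp only [pd]
  rw [fderiv_fun_sum (fun k _ => differentiableAt_of_smooth (hf k) x)]
  simp

theorem pd_const (i : Fin m) (c : ℝ) (x : Coord m) : pd i (fun _ => c) x = 0 := by
  simp [pd]

theorem pd_exp (i : Fin m) {f : Coord m → ℝ} (hf : ContDiff ℝ ∞ f) (x : Coord m) :
    pd i (fun z => Real.exp (f z)) x = Real.exp (f x) * pd i f x := by
  simp only [pd]
  rw [fderiv_exp (differentiableAt_of_smooth hf x)]
  rfl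

theorem pd_comm (i j : Fin m) {f : Coord m → ℝ} (hf : ContDiff ℝ ∞ f) (x : Coord m) :
    pd i (pd j f) x = pd j (pd i f) x := by
  have hd : DifferentiableAt ℝ (fderiv ℝ f) x :=
    (hf.fderiv_right (m := ∞) (by simp)).differentiable (by simp) x
  have key (k l : Fin m) : pd k (pd l f) x = fderiv ℝ (fderiv ℝ f) x (coordVec k) (coordVec l) := by
    have : pd l f = fun z => fderiv ℝ f z (coordVec l) := rfl
    rw [pd, this, fderiv_clm_apply hd (differentiableAt_const _)]
    simp
  rw [key, key]
  have h2 : (2 : WithTop ℕ∞) ≤ ∞ := WithTop.coe_le_coe.2 (le_top : (2 : ℕ∞) ≤ ⊤)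
  exact (hf.contDiffAt.isSymmSndFDerivAt (by simpa using h2)).eq _ _

theorem pd_eq_zero_of_notMem_tsupport (i : Fin m) {f : Coord m → ℝ} {x : Coord m}
    (hx : x ∉ tsupport f) : pd i f x = 0 := by
  rw [pd, fderiv_of_notMem_tsupport ℝ hx]; rfl

theorem tsupport_pd_subset (i : Fin m) (f : Coord m → ℝ) : tsupport (pd i f) ⊆ tsupport f := by
  refine closure_minimal (fun x hx => ?_) (isClosed_tsupport f)
  by_contra h
  exact hx (pd_eq_zero_of_notMem_tsupport i h)

theorem integral_pd_eq_zero (i : Fin m) {f : Coord m → ℝ} (hf : ContDiff ℝ ∞ f)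
    (hc : HasCompactSupport f) : ∫ x, pd i f x = 0 := by
  have hc' : HasCompactSupport (pd i f) :=
    hc.mono' ((subset_tsupport _).trans (tsupport_pd_subset i f))
  have hi' : Integrable (pd i f) := (contDiff_pd i hf).continuous.integrable_of_hasCompactSupport hc'
  have hi : Integrable f := hf.continuous.integrable_of_hasCompactSupport hc
  -- Integration by parts against the constant function `1`.
  have := integral_mul_fderiv_eq_neg_fderiv_mul_of_integrable (μ := (volume : Measure (Coord m)))
    (f := f) (g := fun _ => (1 : ℝ)) (v := coordVec i)
    (by simp only [mul_one]; exact hi') (by simp) (by simpa using hi)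
    (fun x _ => differentiableAt_of_smooth hf x) (fun x _ => differentiableAt_const _)
  simp only [fderiv_fun_const, Pi.zero_apply, zero_apply, mul_zero,
    integral_zero, mul_one] at this
  simp only [pd]
  linarith

end Calculus

/-! ### The Carleman estimate for divergence form operators. -/

section Carleman

open MeasureTheory

variable {m : ℕ}

/-- The flux `∑ⱼ aᵢⱼ ∂ⱼv`. -/
def flux (a : Fin m → Fin m → Coord m → ℝ) (v : Coord m → ℝ) (i : Fin m) (x : Coord m) : ℝ :=
  ∑ j, a i j x * pd j v x

/-- The divergence form operator `∑ᵢ ∂ᵢ (∑ⱼ aᵢⱼ ∂ⱼv)`. -/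
def divOp (a : Fin m → Fin m → Coord m → ℝ) (v : Coord m → ℝ) (x : Coord m) : ℝ :=
  ∑ i, pd i (flux a v i) x

/-- The derivative of `v` along the vector field `X`. -/
def along (X : Fin m → Coord m → ℝ) (v : Coord m → ℝ) (x : Coord m) : ℝ :=
  ∑ k, X k x * pd k v x

/-- The divergence of the vector field `X`. -/
def divg (X : Fin m → Coord m → ℝ) (x : Coord m) : ℝ := ∑ i, pd i (X i) x

/-- The quadratic form `∑ aᵢⱼ ξᵢ ξⱼ`. -/
def qform (a : Fin m → Fin m → Coord m → ℝ) (x : Coord m) (ξ : Fin m → ℝ) : ℝ :=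
  ∑ i, ∑ j, a i j x * ξ i * ξ j

/-- The quadratic form `∑ aᵢⱼ ξⱼ (∂ᵢXₖ) ξₖ - ½ ∑ Xₗ (∂ₗaᵢⱼ) ξᵢ ξⱼ`, the Hessian of `ψ` when
`X` is the gradient of `ψ`. -/
def hessForm (a : Fin m → Fin m → Coord m → ℝ) (X : Fin m → Coord m → ℝ) (x : Coord m)
    (ξ : Fin m → ℝ) : ℝ :=
  ∑ i, ∑ k, (∑ j, a i j x * ξ j) * pd i (X k) x * ξ k
    - 1 / 2 * ∑ l, X l x * qform (fun i j => pd l (a i j)) x ξ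

/-- The gradient vector `(∂ᵢv)ᵢ`. -/
def grad (v : Coord m → ℝ) (x : Coord m) (i : Fin m) : ℝ := pd i v x

variable {a : Fin m → Fin m → Coord m → ℝ} {X : Fin m → Coord m → ℝ}

@[fun_prop]
theorem contDiff_flux (ha : ∀ i j, ContDiff ℝ ∞ (a i j)) {v : Coord m → ℝ}
    (hv : ContDiff ℝ ∞ v) (i : Fin m) : ContDiff ℝ ∞ (flux a v i) := by
  unfold flux; fun_prop

@[fun_prop]
theorem contDiff_along (hX : ∀ i, ContDiff ℝ ∞ (X i)) {v : Coord m → ℝ}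
    (hv : ContDiff ℝ ∞ v) : ContDiff ℝ ∞ (along X v) := by
  unfold along; fun_prop

@[fun_prop]
theorem contDiff_divg (hX : ∀ i, ContDiff ℝ ∞ (X i)) : ContDiff ℝ ∞ (divg X) := by
  unfold divg; fun_prop

@[fun_prop]
theorem contDiff_divOp (ha : ∀ i j, ContDiff ℝ ∞ (a i j)) {v : Coord m → ℝ}
    (hv : ContDiff ℝ ∞ v) : ContDiff ℝ ∞ (divOp a v) := by
  unfold divOp; fun_prop

theorem contDiff_qform_grad (ha : ∀ i j, ContDiff ℝ ∞ (a i j)) {v : Coord m → ℝ}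
    (hv : ContDiff ℝ ∞ v) : ContDiff ℝ ∞ (fun x => qform a x (grad v x)) := by
  unfold qform grad; fun_prop

theorem pd_along (hX : ∀ i, ContDiff ℝ ∞ (X i)) {v : Coord m → ℝ}
    (hv : ContDiff ℝ ∞ v) (i : Fin m) (x : Coord m) :
    pd i (along X v) x = ∑ k, pd i (X k) x * pd k v x + ∑ k, X k x * pd k (pd i v) x := by
  have : along X v = fun z => ∑ k, X k z * pd k v z := rfl
  rw [this, pd_sum _ _ (fun k => by fun_prop), ← Finset.sum_add_distrib]
  refine Finset.sum_congr rfl fun k _ => ?_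
  rw [pd_mul _ (hX k) (by fun_prop), pd_comm i k hv]; ring

/-- Differentiating either gradient factor gives the same sum because `a` is symmetric, hence the
coefficient 2. -/
theorem pd_qform_grad (ha : ∀ i j, ContDiff ℝ ∞ (a i j)) (hsymm : ∀ i j x, a i j x = a j i x)
    {v : Coord m → ℝ} (hv : ContDiff ℝ ∞ v) (l : Fin m) (x : Coord m) :
    pd l (fun z => qform a z (grad v z)) x
      = qform (fun i j => pd l (a i j)) x (grad v x) + 2 * ∑ i, flux a v i x * pd l (pd i v) x := by
  have h1 : pd l (fun z => qform a z (grad v z)) x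
      = ∑ i, ∑ j, (pd l (a i j) x * grad v x i * grad v x j
        + a i j x * pd l (pd i v) x * pd j v x + a i j x * pd i v x * pd l (pd j v) x) := by
    simp only [qform, grad]
    rw [pd_sum _ _ (fun k => by fun_prop)]
    refine Finset.sum_congr rfl fun i _ => ?_
    rw [pd_sum _ _ (fun k => by fun_prop)]
    refine Finset.sum_congr rfl fun j _ => ?_
    rw [pd_mul _ (by fun_prop) (by fun_prop), pd_mul _ (ha i j) (by fun_prop)]
    ring
  have h2 : ∑ i, ∑ j, a i j x * pd i v x * pd l (pd j v) x
      = ∑ i, flux a v i x * pd l (pd i v) x := by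
    rw [Finset.sum_comm]
    refine Finset.sum_congr rfl fun i _ => ?_
    rw [flux, Finset.sum_mul]
    exact Finset.sum_congr rfl fun j _ => by rw [hsymm]
  have h3 : ∑ i, ∑ j, a i j x * pd l (pd i v) x * pd j v x
      = ∑ i, flux a v i x * pd l (pd i v) x := by
    refine Finset.sum_congr rfl fun i _ => ?_
    rw [flux, Finset.sum_mul]
    exact Finset.sum_congr rfl fun j _ => by ring
  rw [h1]
  simp only [Finset.sum_add_distrib]
  rw [h2, h3, qform]; ring

/-- The vector field whose divergence appears in the Carleman identity. -/
def carlemanFlux (a : Fin m → Fin m → Coord m → ℝ) (X : Fin m → Coord m → ℝ)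
    (A β : Coord m → ℝ) (T : ℝ) (v : Coord m → ℝ) (i : Fin m) (x : Coord m) : ℝ :=
  2 * (flux a v i x * along X v x) - X i x * qform a x (grad v x)
    + T * (A x * X i x * (v x * v x)) + β x * v x * flux a v i x

/-- The multiplier method: `Lv + TAv` is multiplied by `2Xv + (div X + κ)v` and everything is
integrated by parts, recorded here as a pointwise identity with an exact divergence. The choice `div
X` in the multiplier cancels the indefinite terms `(div X) q(∇v)` and `T A (div X) v²`; the free
function `κ` later shifts positivity between the gradient term and the `v²` term. -/
theorem divg_carlemanFlux (ha : ∀ i j, ContDiff ℝ ∞ (a i j))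
    (hsymm : ∀ i j x, a i j x = a j i x) (hX : ∀ i, ContDiff ℝ ∞ (X i)) {A κ : Coord m → ℝ}
    (hA : ContDiff ℝ ∞ A) (hκ : ContDiff ℝ ∞ κ) (T : ℝ) {v : Coord m → ℝ} (hv : ContDiff ℝ ∞ v)
    (x : Coord m) :
    divg (carlemanFlux a X A (fun z => divg X z + κ z) T v) x
      = (divOp a v x + T * A x * v x) * (2 * along X v x + (divg X x + κ x) * v x)
        + (2 * hessForm a X x (grad v x) + κ x * qform a x (grad v x))
        + T * (along X A x - κ x * A x) * (v x * v x)
        + v x * ∑ i, flux a v i x * pd i (fun z => divg X z + κ z) x := by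
  set β : Coord m → ℝ := fun z => divg X z + κ z with hβ
  have hβs : ContDiff ℝ ∞ β := by fun_prop
  have hq := contDiff_qform_grad ha hv
  have h1 (i : Fin m) : pd i (carlemanFlux a X A β T v i) x
      = 2 * (flux a v i x * pd i (along X v) x + pd i (flux a v i) x * along X v x)
        - (X i x * pd i (fun z => qform a z (grad v z)) x + pd i (X i) x * qform a x (grad v x))
        + T * (A x * X i x * (2 * v x * pd i v x)
          + (A x * pd i (X i) x + X i x * pd i A x) * (v x * v x))
        + (β x * v x * pd i (flux a v i) x
          + (β x * pd i v x + pd i β x * v x) * flux a v i x) := by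
    have : carlemanFlux a X A β T v i = fun x =>
      2 * (flux a v i x * along X v x) - X i x * qform a x (grad v x)
      + T * (A x * X i x * (v x * v x)) + β x * v x * flux a v i x := rfl
    rw [this, pd_add _ (by fun_prop) (by fun_prop), pd_add _ (by fun_prop) (by fun_prop),
      pd_sub _ (by fun_prop) (by fun_prop), pd_mul _ contDiff_const (by fun_prop),
      pd_mul _ (by fun_prop) (by fun_prop), pd_mul _ (by fun_prop) hq,
      pd_mul _ contDiff_const (by fun_prop), pd_mul _ (by fun_prop) (by fun_prop),
      pd_mul _ hA (by fun_prop), pd_mul _ hv hv, pd_mul _ (by fun_prop) (by fun_prop),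
      pd_mul _ hβs hv, pd_const, pd_const]
    ring
  have hqv : ∑ i, pd i v x * flux a v i x = qform a x (grad v x) := by
    simp only [qform, flux, grad, Finset.mul_sum]
    exact Finset.sum_congr rfl fun i _ => Finset.sum_congr rfl fun j _ => by ring
  have hsw : ∑ i, flux a v i x * ∑ k, X k x * pd k (pd i v) x
      = ∑ l, X l x * ∑ i, flux a v i x * pd l (pd i v) x := by
    simp only [Finset.mul_sum]
    rw [Finset.sum_comm]
    exact Finset.sum_congr rfl fun i _ => Finset.sum_congr rfl fun j _ => by ring
  have hh : ∑ i, flux a v i x * ∑ k, pd i (X k) x * pd k v x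
      = hessForm a X x (grad v x)
        + 1 / 2 * ∑ l, X l x * qform (fun i j => pd l (a i j)) x (grad v x) := by
    simp only [hessForm, sub_add_cancel, Finset.mul_sum, ← mul_assoc]
    rfl
  have e1 : ∑ i, flux a v i x * pd i (along X v) x
      = (hessForm a X x (grad v x)
        + 1 / 2 * ∑ l, X l x * qform (fun i j => pd l (a i j)) x (grad v x))
        + ∑ l, X l x * ∑ i, flux a v i x * pd l (pd i v) x := by
    simp only [pd_along hX hv, mul_add, Finset.sum_add_distrib, hh, hsw]
  -- The second derivatives of `v` appear here with coefficient 2 and in twice `e1` as well, so they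
  -- cancel in the difference.
  have e2 : ∑ i, X i x * pd i (fun z => qform a z (grad v z)) x
      = ∑ l, X l x * qform (fun i j => pd l (a i j)) x (grad v x)
        + 2 * ∑ l, X l x * ∑ i, flux a v i x * pd l (pd i v) x := by
    simp only [pd_qform_grad ha hsymm hv, mul_add, Finset.sum_add_distrib, Finset.mul_sum]
    congr 1
    exact Finset.sum_congr rfl fun i _ => Finset.sum_congr rfl fun j _ => by ring
  have e3 : ∑ i, (A x * X i x * (2 * v x * pd i v x)
          + (A x * pd i (X i) x + X i x * pd i A x) * (v x * v x))
      = 2 * A x * v x * along X v x + (A x * divg X x + along X A x) * (v x * v x) := by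
    simp only [along, divg, Finset.mul_sum, ← Finset.sum_add_distrib, Finset.sum_mul]
    exact Finset.sum_congr rfl fun i _ => by ring
  have e4 : ∑ i, (β x * v x * pd i (flux a v i) x
          + (β x * pd i v x + pd i β x * v x) * flux a v i x)
      = β x * v x * divOp a v x + β x * qform a x (grad v x)
        + v x * ∑ i, flux a v i x * pd i β x := by
    rw [← hqv]
    simp only [divOp, Finset.mul_sum, ← Finset.sum_add_distrib]
    exact Finset.sum_congr rfl fun i _ => by ring
  have e5 : ∑ i, pd i (flux a v i) x * along X v x = divOp a v x * along X v x := by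
    rw [divOp, Finset.sum_mul]
  have e6 : ∑ i, pd i (X i) x * qform a x (grad v x) = divg X x * qform a x (grad v x) := by
    rw [divg, Finset.sum_mul]
  rw [divg]
  simp only [h1]
  rw [Finset.sum_add_distrib, Finset.sum_add_distrib, Finset.sum_sub_distrib, ← Finset.mul_sum,
    ← Finset.mul_sum, Finset.sum_add_distrib, e3, e4]
  rw [Finset.sum_add_distrib (f := fun i => X i x * pd i (fun z => qform a z (grad v z)) x), e1, e2,
    e5, e6]
  simp only [hβ]
  ring

/-- The operator `v ↦ e^{tψ} L (e^{-tψ} v)` for `L = divOp a` applied to `v = e^{tψ} w`. -/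
theorem divOp_conjugate (ha : ∀ i j, ContDiff ℝ ∞ (a i j))
    (hsymm : ∀ i j x, a i j x = a j i x) {ψ w : Coord m → ℝ} (hψ : ContDiff ℝ ∞ ψ)
    (hw : ContDiff ℝ ∞ w) (t : ℝ) (x : Coord m) :
    let v := fun z => Real.exp (t * ψ z) * w z
    Real.exp (t * ψ x) * divOp a w x
      = divOp a v x - 2 * t * along (flux a ψ) v x
        + t ^ 2 * along (flux a ψ) ψ x * v x - t * divg (flux a ψ) x * v x := by
  intro v
  have hpv (j : Fin m) (z : Coord m) :
      pd j v z = Real.exp (t * ψ z) * (pd j w z + t * pd j ψ z * w z) := by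
    simp only [v]
    rw [pd_mul _ (by fun_prop) hw, pd_exp _ (by fun_prop), pd_mul _ contDiff_const hψ, pd_const]
    ring
  have hfl (i : Fin m) : flux a v i
      = fun z => Real.exp (t * ψ z) * (flux a w i z + t * (flux a ψ i z * w z)) := by
    funext z
    simp only [flux, hpv, mul_add, Finset.mul_sum, Finset.sum_mul, ← Finset.sum_add_distrib]
    exact Finset.sum_congr rfl fun j _ => by ring
  have hdf (i : Fin m) : pd i (flux a v i) x = Real.exp (t * ψ x) *
      (pd i (flux a w i) x + t * (flux a ψ i x * pd i w x) + t * (pd i (flux a ψ i) x * w x)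
        + t * (pd i ψ x * flux a w i x) + t ^ 2 * (flux a ψ i x * pd i ψ x) * w x) := by
    rw [hfl, pd_mul _ (by fun_prop) (by fun_prop), pd_exp _ (by fun_prop),
      pd_mul _ contDiff_const hψ, pd_add _ (by fun_prop) (by fun_prop),
      pd_mul _ contDiff_const (by fun_prop), pd_mul _ (by fun_prop) hw, pd_const]
    ring
  have hs : ∑ i, pd i ψ x * flux a w i x = along (flux a ψ) w x := by
    simp only [along, flux, Finset.mul_sum, Finset.sum_mul]
    rw [Finset.sum_comm]
    exact Finset.sum_congr rfl fun i _ => Finset.sum_congr rfl fun j _ => by rw [hsymm i j]; ring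
  have hL : divOp a v x = Real.exp (t * ψ x) *
      (divOp a w x + t * along (flux a ψ) w x + t * (divg (flux a ψ) x * w x)
        + t * along (flux a ψ) w x + t ^ 2 * along (flux a ψ) ψ x * w x) := by
    rw [divOp]
    simp only [hdf]
    rw [← Finset.mul_sum]
    simp only [Finset.sum_add_distrib, ← Finset.mul_sum, hs, ← Finset.sum_mul]
    rfl
  have hal : along (flux a ψ) v x = Real.exp (t * ψ x) *
      (along (flux a ψ) w x + t * along (flux a ψ) ψ x * w x) := by
    simp only [along, hpv, mul_add, Finset.mul_sum, Finset.sum_mul, ← Finset.sum_add_distrib]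
    exact Finset.sum_congr rfl fun j _ => by ring
  rw [hL, hal]
  simp only [v]
  ring

/-- The bound is taken to be at least 1 so that it may be divided by. -/
theorem exists_bound_on_compact {K : Set (Coord m)} (hK : IsCompact K) {f : Coord m → ℝ}
    (hf : Continuous f) : ∃ B : ℝ, 1 ≤ B ∧ ∀ x ∈ K, |f x| ≤ B := by
  obtain ⟨B, hB⟩ := hK.exists_bound_of_continuousOn hf.continuousOn
  exact ⟨max B 1, le_max_right _ _, fun x hx => (hB x hx).trans (le_max_left _ _)⟩

theorem sq_sum_le_bound {b ξ : Fin m → ℝ} {B : ℝ} (hB : ∑ i, b i ^ 2 ≤ B) :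
    (∑ i, ξ i * b i) ^ 2 ≤ B * ∑ i, ξ i ^ 2 := by
  refine (Finset.sum_mul_sq_le_sq_mul_sq _ _ _).trans ?_
  rw [mul_comm]
  exact mul_le_mul_of_nonneg_right hB (Finset.sum_nonneg fun i _ => sq_nonneg _)

/-- The absorption argument at a single point. The zeroth order remainder `tκv` costs `t² v²` and
the cross term `vb` costs `t v²` after Young's inequality; for large `t` both are dominated by `t³
v²`. Here `G` stands for `|∇v|²`, `L` for the conjugated operator applied to `v`, and `S` for the
divergence term that will integrate to zero. -/
theorem carleman_real_inequality {t c Ck B G L D Q S κ v b : ℝ} (hc : 0 < c) (hB : 1 ≤ B)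
    (ht1 : 1 ≤ t) (ht : (2 * Ck + 2 * B / c) / c ≤ t) (hκ : κ ^ 2 ≤ Ck) (hb : b ^ 2 ≤ B * G)
    (h1 : c * G ≤ Q) (h2 : c ≤ D)
    (h : t * Q + 2 * t ^ 3 * D * v ^ 2 ≤ (L - t * κ * v) ^ 2 + S - 2 * t * (v * b)) :
    t * (c / 4 * G) + t ^ 3 * (c / 2) * v ^ 2 ≤ L ^ 2 + S / 2 := by
  have ht0 : 0 < t := by linarith
  have a1 : t * (c * G) ≤ t * Q := mul_le_mul_of_nonneg_left h1 ht0.le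
  have a2 : 2 * t ^ 3 * c * v ^ 2 ≤ 2 * t ^ 3 * D * v ^ 2 := by gcongr
  have a3 : (L - t * κ * v) ^ 2 ≤ 2 * L ^ 2 + 2 * (t ^ 2 * (Ck * v ^ 2)) := by
    have : (t * κ * v) ^ 2 ≤ t ^ 2 * (Ck * v ^ 2) := by
      have := mul_le_mul_of_nonneg_right hκ (sq_nonneg (t * v))
      nlinarith
    nlinarith [sq_nonneg (L + t * κ * v)]
  have a4 : -(2 * (v * b)) ≤ c / 2 * G + 2 * B / c * v ^ 2 := by
    have e1 : c / (2 * B) * b ^ 2 ≤ c / 2 * G := by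
      calc c / (2 * B) * b ^ 2 ≤ c / (2 * B) * (B * G) := by gcongr
        _ = c / 2 * G := by field_simp
    have e2 : 0 ≤ c / (2 * B) * b ^ 2 + 2 * (v * b) + 2 * B / c * v ^ 2 := by
      have : c / (2 * B) * b ^ 2 + 2 * (v * b) + 2 * B / c * v ^ 2
          = c / (2 * B) * (b + 2 * B / c * v) ^ 2 := by field_simp; ring
      rw [this]; positivity
    linarith
  have a5 := mul_le_mul_of_nonneg_left a4 ht0.le
  have a6 : 2 * Ck + 2 * B / c ≤ t * c := by rwa [div_le_iff₀ hc] at ht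
  have a7 : t ^ 2 * (2 * Ck + 2 * B / c) * v ^ 2 ≤ t ^ 2 * (t * c) * v ^ 2 := by gcongr
  have a8 : t * (2 * B / c * v ^ 2) ≤ t ^ 2 * (2 * B / c) * v ^ 2 := by
    have : t ≤ t ^ 2 := by nlinarith
    calc t * (2 * B / c * v ^ 2) ≤ t ^ 2 * (2 * B / c * v ^ 2) := by gcongr
      _ = _ := by ring
  nlinarith

/-- A Carleman estimate for a divergence form operator, under a pseudoconvexity condition on the
weight `ψ`. -/
theorem carleman_estimate (ha : ∀ i j, ContDiff ℝ ∞ (a i j))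
    (hsymm : ∀ i j x, a i j x = a j i x) {ψ κ : Coord m → ℝ} (hψ : ContDiff ℝ ∞ ψ)
    (hκ : ContDiff ℝ ∞ κ) {K : Set (Coord m)} (hK : IsCompact K) {c : ℝ} (hc : 0 < c)
    (h1 : ∀ x ∈ K, ∀ ξ : Fin m → ℝ,
      c * ∑ i, ξ i ^ 2 ≤ 4 * hessForm a (flux a ψ) x ξ + 2 * κ x * qform a x ξ)
    (h2 : ∀ x ∈ K, c ≤ along (flux a ψ) (along (flux a ψ) ψ) x - κ x * along (flux a ψ) ψ x) :
    ∃ s > 0, ∃ t₀ : ℝ, 1 ≤ t₀ ∧ ∀ t ≥ t₀, ∀ w : Coord m → ℝ, ContDiff ℝ ∞ w → tsupport w ⊆ K →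
      s * ∫ x, Real.exp (t * ψ x) ^ 2 * (t * ∑ i, pd i w x ^ 2 + t ^ 3 * w x ^ 2)
        ≤ ∫ x, Real.exp (t * ψ x) ^ 2 * divOp a w x ^ 2 := by
  set X := flux a ψ with hXdef
  set A := along X ψ with hAdef
  have hX (i) : ContDiff ℝ ∞ (X i) := contDiff_flux ha hψ i
  have hA : ContDiff ℝ ∞ A := contDiff_along hX hψ
  set β : Coord m → ℝ := fun z => divg X z + κ z with hβ
  have hβs : ContDiff ℝ ∞ β := by fun_prop
  obtain ⟨Ck, -, hCk⟩ := exists_bound_on_compact hK (f := fun x => κ x ^ 2) (by fun_prop)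
  obtain ⟨B, hB1, hB⟩ := exists_bound_on_compact hK
    (f := fun x => ∑ j, (∑ i, a i j x * pd i β x) ^ 2)
    (ContDiff.continuous (n := ∞) (by fun_prop))
  obtain ⟨Bψ, hBψ1, hBψ⟩ := exists_bound_on_compact hK
    (f := fun x => ∑ j, pd j ψ x ^ 2) (ContDiff.continuous (n := ∞) (by fun_prop))
  -- The factor `1 / (8 Bψ)` pays for returning from `v = e^{tψ} w` to `w`, where `e^{tψ} ∂w = ∂v -
  -- t (∂ψ) v`. The threshold for `t` is the one required by `carleman_real_inequality`.
  refine ⟨c / (8 * Bψ), by positivity, max 1 ((2 * Ck + 2 * B / c) / c), le_max_left _ _, ?_⟩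
  intro t ht w hw hwK
  have ht1 : 1 ≤ t := (le_max_left _ _).trans ht
  have ht2 : (2 * Ck + 2 * B / c) / c ≤ t := (le_max_right _ _).trans ht
  have hwc : HasCompactSupport w := hK.of_isClosed_subset (isClosed_tsupport w) hwK
  set v : Coord m → ℝ := fun z => Real.exp (t * ψ z) * w z with hv
  have hvs : ContDiff ℝ ∞ v := by fun_prop
  set F : Fin m → Coord m → ℝ := carlemanFlux a X A β (t ^ 2) v with hF
  have hFs (i) : ContDiff ℝ ∞ (F i) := by
    have := contDiff_qform_grad ha hvs
    have e : F i = fun x => 2 * (flux a v i x * along X v x) - X i x * qform a x (grad v x)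
      + t ^ 2 * (A x * X i x * (v x * v x)) + β x * v x * flux a v i x := rfl
    rw [e]; fun_prop
  have hpw0 (i : Fin m) {x : Coord m} (hx : x ∉ tsupport w) : pd i w x = 0 :=
    pd_eq_zero_of_notMem_tsupport i hx
  have hvw : tsupport v ⊆ tsupport w := tsupport_mul_subset_right
  have hpv0 (i : Fin m) {x : Coord m} (hx : x ∉ tsupport w) : pd i v x = 0 :=
    pd_eq_zero_of_notMem_tsupport i fun h => hx (hvw h)
  have hFc (i) : HasCompactSupport (F i) := by
    refine HasCompactSupport.intro hwc.isCompact fun x hx => ?_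
    have hv0 : v x = 0 := image_eq_zero_of_notMem_tsupport fun h => hx (hvw h)
    simp [hF, carlemanFlux, flux, qform, grad, hpv0 _ hx, hv0]
  -- The estimate holds pointwise up to an exact divergence; integration then removes that
  -- divergence.
  have hpoint (x : Coord m) : c / (8 * Bψ) *
        (Real.exp (t * ψ x) ^ 2 * (t * ∑ i, pd i w x ^ 2 + t ^ 3 * w x ^ 2))
      ≤ Real.exp (t * ψ x) ^ 2 * divOp a w x ^ 2 + t * divg F x := by
    by_cases hx : x ∈ tsupport w
    · have hxK := hwK hx
      have hdiv := divg_carlemanFlux ha hsymm hX hA hκ (t ^ 2) hvs x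
      have hconj := divOp_conjugate ha hsymm hψ hw t x
      simp only [← hXdef, ← hv, ← hAdef] at hconj
      have hbsum : ∑ i, flux a v i x * pd i β x
          = ∑ j, grad v x j * ∑ i, a i j x * pd i β x := by
        simp only [flux, Finset.mul_sum, Finset.sum_mul]
        rw [Finset.sum_comm]
        exact Finset.sum_congr rfl fun i _ => Finset.sum_congr rfl fun j _ => by
          rw [grad]; ring
      have hb : (∑ i, flux a v i x * pd i β x) ^ 2 ≤ B * ∑ i, grad v x i ^ 2 := by
        rw [hbsum]
        exact sq_sum_le_bound ((le_abs_self _).trans (hB x hxK))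
      have key := carleman_real_inequality (t := t) (G := ∑ i, grad v x i ^ 2)
        (L := Real.exp (t * ψ x) * divOp a w x) (S := 2 * t * divg F x) (v := v x) hc hB1 ht1 ht2
        ((le_abs_self _).trans (hCk x hxK)) hb (h1 x hxK (grad v x)) (h2 x hxK) (by
          rw [hF, hβ, hdiv, hconj]
          -- With `P = Lv + t²Av` and `M = 2Xv + (div X + κ)v`, the conjugated operator minus `tκv`
          -- is `P - tM`. Dropping `P² + t²M²` from its square leaves `-2tPM`, which the divergence
          -- identity evaluates.
          nlinarith [sq_nonneg (divOp a v x + t ^ 2 * A x * v x),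
            sq_nonneg (2 * t * along X v x + t * (divg X x + κ x) * v x)])
      have hgrad : Real.exp (t * ψ x) ^ 2 * ∑ i, pd i w x ^ 2
          ≤ 2 * ∑ i, grad v x i ^ 2 + 2 * t ^ 2 * (Bψ * v x ^ 2) := by
        have e1 (i : Fin m) : Real.exp (t * ψ x) ^ 2 * pd i w x ^ 2
            ≤ 2 * grad v x i ^ 2 + 2 * t ^ 2 * (pd i ψ x ^ 2 * v x ^ 2) := by
          have : Real.exp (t * ψ x) * pd i w x = grad v x i - t * pd i ψ x * v x := by
            simp only [grad, hv]
            rw [pd_mul _ (by fun_prop) hw, pd_exp _ (by fun_prop), pd_mul _ contDiff_const hψ,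
              pd_const]
            ring
          rw [← mul_pow, this]
          nlinarith [sq_nonneg (grad v x i + t * pd i ψ x * v x)]
        rw [Finset.mul_sum]
        refine (Finset.sum_le_sum fun i _ => e1 i).trans ?_
        rw [Finset.sum_add_distrib, ← Finset.mul_sum, ← Finset.mul_sum, ← Finset.sum_mul]
        have := (le_abs_self _).trans (hBψ x hxK)
        gcongr
      have hw2 : Real.exp (t * ψ x) ^ 2 * w x ^ 2 = v x ^ 2 := by rw [hv, mul_pow]
      have hs : 0 < c / (8 * Bψ) := by positivity
      have hG : 0 ≤ ∑ i, grad v x i ^ 2 := Finset.sum_nonneg fun i _ => sq_nonneg _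
      have ht0 : 0 < t := by linarith
      have b1 := mul_le_mul_of_nonneg_left hgrad (mul_pos hs ht0).le
      have b2 : c / (8 * Bψ) * Bψ = c / 8 := by field_simp
      have b3 : c / (8 * Bψ) ≤ c / 8 := by
        rw [← b2]; exact le_mul_of_one_le_right hs.le hBψ1
      have b4 : c / (8 * Bψ) * (t * ∑ i, grad v x i ^ 2) ≤ c / 8 * (t * ∑ i, grad v x i ^ 2) := by
        gcongr
      have b5 : c / (8 * Bψ) * (t ^ 3 * v x ^ 2) ≤ c / 8 * (t ^ 3 * v x ^ 2) := by gcongr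
      have b6 : c / (8 * Bψ) * t * (2 * t ^ 2 * (Bψ * v x ^ 2)) = c / 4 * (t ^ 3 * v x ^ 2) := by
        calc _ = c / (8 * Bψ) * Bψ * (2 * t ^ 3 * v x ^ 2) := by ring
          _ = _ := by rw [b2]; ring
      have b7 : 0 ≤ c * (t ^ 3 * v x ^ 2) := by positivity
      calc _ = c / (8 * Bψ) * t * (Real.exp (t * ψ x) ^ 2 * ∑ i, pd i w x ^ 2)
            + c / (8 * Bψ) * (t ^ 3 * (Real.exp (t * ψ x) ^ 2 * w x ^ 2)) := by ring
        _ ≤ (Real.exp (t * ψ x) * divOp a w x) ^ 2 + t * divg F x := by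
          rw [hw2]; linarith
        _ = _ := by rw [mul_pow]
    · have hw0 : w x = 0 := image_eq_zero_of_notMem_tsupport hx
      have hF0 : divg F x = 0 := by
        refine Finset.sum_eq_zero fun i _ => pd_eq_zero_of_notMem_tsupport i fun h => hx ?_
        refine closure_minimal (fun y hy => ?_) (isClosed_tsupport w) h
        by_contra hy'
        refine hy ?_
        have hv0 : v y = 0 := image_eq_zero_of_notMem_tsupport fun h => hy' (hvw h)
        simp [hF, carlemanFlux, flux, qform, grad, hpv0 _ hy', hv0]
      rw [hF0]
      simp only [hpw0 _ hx, hw0]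
      have : (0 : ℝ) ≤ Real.exp (t * ψ x) ^ 2 * divOp a w x ^ 2 := by positivity
      simpa using this
  have hi1 : Integrable fun x =>
      Real.exp (t * ψ x) ^ 2 * (t * ∑ i, pd i w x ^ 2 + t ^ 3 * w x ^ 2) := by
    refine Continuous.integrable_of_hasCompactSupport
      (ContDiff.continuous (n := ∞) (by fun_prop)) ?_
    refine HasCompactSupport.intro hwc.isCompact fun x hx => ?_
    simp [hpw0 _ hx, image_eq_zero_of_notMem_tsupport hx]
  have hi2 : Integrable fun x => Real.exp (t * ψ x) ^ 2 * divOp a w x ^ 2 := by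
    refine Continuous.integrable_of_hasCompactSupport
      (ContDiff.continuous (n := ∞) (by fun_prop)) ?_
    refine HasCompactSupport.intro hwc.isCompact fun x hx => ?_
    have : divOp a w x = 0 := by
      refine Finset.sum_eq_zero fun i _ => pd_eq_zero_of_notMem_tsupport i fun h => hx ?_
      refine closure_minimal (fun y hy => ?_) (isClosed_tsupport w) h
      by_contra hy'
      exact hy (by simp [flux, hpw0 _ hy'])
    simp [this]
  have hi3' (i : Fin m) : Integrable (pd i (F i)) :=
    (contDiff_pd i (hFs i)).continuous.integrable_of_hasCompactSupport
      ((hFc i).mono' ((subset_tsupport _).trans (tsupport_pd_subset i (F i))))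
  have hi3 : Integrable (divg F) := by
    unfold divg
    exact integrable_finsetSum _ fun i _ => hi3' i
  -- The flux has compact support because `w` does.
  have hF0 : ∫ x, divg F x = 0 := by
    unfold divg
    rw [integral_finsetSum _ fun i _ => hi3' i]
    exact Finset.sum_eq_zero fun i _ => integral_pd_eq_zero i (hFs i) (hFc i)
  rw [← integral_const_mul]
  calc _ ≤ ∫ x, (Real.exp (t * ψ x) ^ 2 * divOp a w x ^ 2 + t * divg F x) :=
        integral_mono (hi1.const_mul _) (hi2.add (hi3.const_mul t)) hpoint
    _ = _ := by rw [integral_add hi2 (hi3.const_mul t), integral_const_mul, hF0]; simp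

end Carleman

/-! ### Convexified weights and unique continuation in an annulus. -/

section UniqueContinuation

open MeasureTheory

variable {m : ℕ} {a : Fin m → Fin m → Coord m → ℝ}

theorem exists_pos_lower_bound {T : Type*} [TopologicalSpace T] {K : Set T} (hK : IsCompact K)
    {f : T → ℝ} (hf : ContinuousOn f K) (hpos : ∀ x ∈ K, 0 < f x) :
    ∃ c > 0, ∀ x ∈ K, c ≤ f x := by
  rcases K.eq_empty_or_nonempty with rfl | hne
  · exact ⟨1, one_pos, by simp⟩
  · obtain ⟨x, hx, hmin⟩ := hK.exists_isMinOn hne hf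
    exact ⟨f x, hpos x hx, fun y hy => hmin hy⟩

theorem isCompact_sum_sq_eq_one : IsCompact {ξ : Fin m → ℝ | ∑ i, ξ i ^ 2 = 1} := by
  refine (isCompact_closedBall (0 : Fin m → ℝ) 1).of_isClosed_subset
    (isClosed_eq (by fun_prop) continuous_const) fun ξ hξ => ?_
  rw [mem_closedBall_zero_iff, pi_norm_le_iff_of_nonneg zero_le_one]
  intro i
  rw [Real.norm_eq_abs, ← sq_le_one_iff_abs_le_one, ← hξ.out]
  exact Finset.single_le_sum (f := fun i => ξ i ^ 2) (fun i _ => sq_nonneg _) (Finset.mem_univ i)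

theorem exists_unit_multiple {ξ : Fin m → ℝ} (hξ : ξ ≠ 0) :
    ∃ η : Fin m → ℝ, ∑ i, η i ^ 2 = 1 ∧ ξ = (√(∑ i, ξ i ^ 2)) • η := by
  have hpos : 0 < ∑ i, ξ i ^ 2 := by
    refine lt_of_le_of_ne (Finset.sum_nonneg fun i _ => sq_nonneg _) fun h => hξ ?_
    funext i
    have := (Finset.sum_eq_zero_iff_of_nonneg fun i _ => sq_nonneg (ξ i)).1 h.symm i
      (Finset.mem_univ i)
    simpa using this
  have hs : 0 < √(∑ i, ξ i ^ 2) := Real.sqrt_pos.2 hpos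
  refine ⟨(√(∑ i, ξ i ^ 2))⁻¹ • ξ, ?_, by rw [smul_smul, mul_inv_cancel₀ hs.ne', one_smul]⟩
  simp only [Pi.smul_apply, smul_eq_mul, mul_pow, ← Finset.mul_sum, inv_pow,
    Real.sq_sqrt hpos.le]
  exact inv_mul_cancel₀ hpos.ne'

/-- By homogeneity of degree two it suffices to minimise over the compact set `K × S^{m-1}`. -/
theorem exists_pos_quadratic_lower_bound {K : Set (Coord m)} (hK : IsCompact K)
    {f : Coord m → (Fin m → ℝ) → ℝ} (hf : Continuous fun p : Coord m × (Fin m → ℝ) => f p.1 p.2)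
    (hhom : ∀ x (r : ℝ) ξ, f x (r • ξ) = r ^ 2 * f x ξ) (hpos : ∀ x ∈ K, ∀ ξ ≠ 0, 0 < f x ξ) :
    ∃ c > 0, ∀ x ∈ K, ∀ ξ, c * ∑ i, ξ i ^ 2 ≤ f x ξ := by
  obtain ⟨c, hc, h⟩ := exists_pos_lower_bound (hK.prod (isCompact_sum_sq_eq_one (m := m)))
    hf.continuousOn (by
      rintro ⟨x, ξ⟩ ⟨hx, hξ⟩
      refine hpos x hx ξ ?_
      rintro rfl
      simp at hξ)
  refine ⟨c, hc, fun x hx ξ => ?_⟩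
  by_cases hξ : ξ = 0
  · have := hhom x 0 0
    rw [smul_zero, zero_pow two_ne_zero, zero_mul] at this
    rw [hξ, this]
    simp
  · obtain ⟨η, hη, e⟩ := exists_unit_multiple hξ
    rw [e, hhom, Real.sq_sqrt (Finset.sum_nonneg fun i _ => sq_nonneg _), ← e, mul_comm]
    exact mul_le_mul_of_nonneg_left (h (x, η) ⟨hx, hη⟩) (Finset.sum_nonneg fun i _ => sq_nonneg _)

theorem exists_quadratic_bound {K : Set (Coord m)} (hK : IsCompact K)
    {f : Coord m → (Fin m → ℝ) → ℝ} (hf : Continuous fun p : Coord m × (Fin m → ℝ) => f p.1 p.2)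
    (hhom : ∀ x (r : ℝ) ξ, f x (r • ξ) = r ^ 2 * f x ξ) :
    ∃ C, ∀ x ∈ K, ∀ ξ, -(C * ∑ i, ξ i ^ 2) ≤ f x ξ := by
  obtain ⟨C, h⟩ := (hK.prod (isCompact_sum_sq_eq_one (m := m))).exists_bound_of_continuousOn
    hf.continuousOn
  refine ⟨C, fun x hx ξ => ?_⟩
  by_cases hξ : ξ = 0
  · have := hhom x 0 0
    rw [smul_zero, zero_pow two_ne_zero, zero_mul] at this
    rw [hξ, this]
    simp
  · obtain ⟨η, hη, e⟩ := exists_unit_multiple hξ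
    rw [e, hhom, Real.sq_sqrt (Finset.sum_nonneg fun i _ => sq_nonneg _), ← e, mul_comm,
      ← mul_neg]
    exact mul_le_mul_of_nonneg_left (abs_le.1 (h (x, η) ⟨hx, hη⟩)).1
      (Finset.sum_nonneg fun i _ => sq_nonneg _)

theorem qform_smul (x : Coord m) (r : ℝ) (ξ : Fin m → ℝ) :
    qform a x (r • ξ) = r ^ 2 * qform a x ξ := by
  simp only [qform, Pi.smul_apply, smul_eq_mul, Finset.mul_sum]
  exact Finset.sum_congr rfl fun i _ => Finset.sum_congr rfl fun j _ => by ring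

theorem hessForm_smul (X : Fin m → Coord m → ℝ) (x : Coord m) (r : ℝ) (ξ : Fin m → ℝ) :
    hessForm a X x (r • ξ) = r ^ 2 * hessForm a X x ξ := by
  simp only [hessForm, qform_smul, Pi.smul_apply, smul_eq_mul, mul_sub]
  congr 1
  · simp only [Finset.mul_sum, Finset.sum_mul]
    exact Finset.sum_congr rfl fun i _ => Finset.sum_congr rfl fun j _ =>
      Finset.sum_congr rfl fun k _ => by ring
  · simp only [Finset.mul_sum]
    exact Finset.sum_congr rfl fun i _ => by ring

theorem along_flux_self (v : Coord m → ℝ) (x : Coord m) :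
    along (flux a v) v x = qform a x (grad v x) := by
  simp only [along, flux, qform, grad, Finset.sum_mul]
  exact Finset.sum_congr rfl fun i _ => Finset.sum_congr rfl fun j _ => by ring

/-- Composition with the exponential adds a nonnegative rank one term in the direction of the
gradient. It may vanish in the other directions, where positivity has to come from `κ`. -/
theorem hessForm_exp (ha : ∀ i j, ContDiff ℝ ∞ (a i j)) (hsymm : ∀ i j x, a i j x = a j i x)
    {φ : Coord m → ℝ} (hφ : ContDiff ℝ ∞ φ) (l : ℝ) (x : Coord m) (ξ : Fin m → ℝ) :
    hessForm a (flux a fun z => Real.exp (l * φ z)) x ξ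
      = l ^ 2 * Real.exp (l * φ x) * (∑ k, flux a φ k x * ξ k) ^ 2
        + l * Real.exp (l * φ x) * hessForm a (flux a φ) x ξ := by
  have hpd (j : Fin m) (z : Coord m) :
      pd j (fun z => Real.exp (l * φ z)) z = l * Real.exp (l * φ z) * pd j φ z := by
    rw [pd_exp _ (by fun_prop), pd_mul _ contDiff_const hφ, pd_const]; ring
  have hfl (k : Fin m) : flux a (fun z => Real.exp (l * φ z)) k
      = fun z => l * Real.exp (l * φ z) * flux a φ k z := by
    funext z
    simp only [flux, hpd, Finset.mul_sum]
    exact Finset.sum_congr rfl fun j _ => by ring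
  have hpf (i k : Fin m) : pd i (flux a (fun z => Real.exp (l * φ z)) k) x
      = l * Real.exp (l * φ x) * pd i (flux a φ k) x
        + l ^ 2 * Real.exp (l * φ x) * (pd i φ x * flux a φ k x) := by
    rw [hfl, pd_mul _ (by fun_prop) (by fun_prop), pd_mul _ contDiff_const (by fun_prop), hpd,
      pd_const]
    ring
  have h1 : ∑ i, (∑ j, a i j x * ξ j) * pd i φ x = ∑ k, flux a φ k x * ξ k := by
    simp only [flux, Finset.sum_mul]
    rw [Finset.sum_comm]
    exact Finset.sum_congr rfl fun i _ => Finset.sum_congr rfl fun j _ => by rw [hsymm]; ring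
  have h2 : ∑ i, ∑ k, (∑ j, a i j x * ξ j) * pd i φ x * (flux a φ k x * ξ k)
      = (∑ k, flux a φ k x * ξ k) ^ 2 := by
    simp only [← Finset.mul_sum]
    rw [← Finset.sum_mul, h1, sq]
  rw [hessForm, hessForm, ← h2]
  simp only [hpf]
  simp only [hfl, mul_sub, Finset.mul_sum]
  rw [← add_sub_assoc, ← Finset.sum_add_distrib]
  congr 1
  · refine Finset.sum_congr rfl fun i _ => ?_
    rw [← Finset.sum_add_distrib]
    exact Finset.sum_congr rfl fun j _ => by ring
  · exact Finset.sum_congr rfl fun i _ => by ring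

/-- The term `2l A²`, with `A = |∇φ|²`, dominates for large `l` where `φ` has no critical point. -/
theorem along_exp (ha : ∀ i j, ContDiff ℝ ∞ (a i j))
    {φ : Coord m → ℝ} (hφ : ContDiff ℝ ∞ φ) (l : ℝ) (x : Coord m) :
    let ψ := fun z => Real.exp (l * φ z)
    along (flux a ψ) ψ x = l ^ 2 * Real.exp (l * φ x) ^ 2 * along (flux a φ) φ x ∧
    along (flux a ψ) (along (flux a ψ) ψ) x
      = l ^ 3 * Real.exp (l * φ x) ^ 3 *
        (2 * l * along (flux a φ) φ x ^ 2 + along (flux a φ) (along (flux a φ) φ) x) := by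
  intro ψ
  have hpd (j : Fin m) (z : Coord m) : pd j ψ z = l * Real.exp (l * φ z) * pd j φ z := by
    simp only [ψ]
    rw [pd_exp _ (by fun_prop), pd_mul _ contDiff_const hφ, pd_const]; ring
  have hfl (k : Fin m) (z : Coord m) : flux a ψ k z
      = l * Real.exp (l * φ z) * flux a φ k z := by
    simp only [flux, hpd, Finset.mul_sum]
    exact Finset.sum_congr rfl fun j _ => by ring
  have h1 : along (flux a ψ) ψ
      = fun z => l ^ 2 * (Real.exp (l * φ z) * Real.exp (l * φ z)) * along (flux a φ) φ z := by
    funext z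
    simp only [along, hpd, hfl, Finset.mul_sum]
    exact Finset.sum_congr rfl fun j _ => by ring
  refine ⟨by rw [h1]; ring, ?_⟩
  have h2 (k : Fin m) : pd k (along (flux a ψ) ψ) x
      = l ^ 2 * Real.exp (l * φ x) ^ 2 *
        (pd k (along (flux a φ) φ) x + 2 * l * along (flux a φ) φ x * pd k φ x) := by
    have h3 : pd k (fun z => Real.exp (l * φ z)) x = l * Real.exp (l * φ x) * pd k φ x := hpd k x
    rw [h1, pd_mul _ (by fun_prop) (by fun_prop), pd_mul _ contDiff_const (by fun_prop),
      pd_mul _ (by fun_prop) (by fun_prop), h3, pd_const]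
    ring
  have h4 (v : Coord m → ℝ) : along (flux a ψ) v x
      = l * Real.exp (l * φ x) * along (flux a φ) v x := by
    simp only [along, hfl, Finset.mul_sum]
    exact Finset.sum_congr rfl fun j _ => by ring
  rw [h4]
  have h5 : along (flux a φ) (along (flux a ψ) ψ) x = l ^ 2 * Real.exp (l * φ x) ^ 2 *
      (along (flux a φ) (along (flux a φ) φ) x + 2 * l * along (flux a φ) φ x
        * along (flux a φ) φ x) := by
    rw [along]
    simp only [h2]
    simp only [along, mul_add, Finset.mul_sum, ← Finset.sum_add_distrib]
    refine Finset.sum_congr rfl fun j _ => ?_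
    rw [← Finset.mul_sum]
    ring
  rw [h5]; ring

/-- Convexification: `exp (l φ)` satisfies the pseudoconvexity condition of `carleman_estimate`
for large `l` when `φ` has no critical point on `K`. -/
theorem exists_carleman_weight (ha : ∀ i j, ContDiff ℝ ∞ (a i j))
    (hsymm : ∀ i j x, a i j x = a j i x) {K : Set (Coord m)} (hK : IsCompact K)
    (hpos : ∀ x ∈ K, ∀ ξ ≠ 0, 0 < qform a x ξ) {φ : Coord m → ℝ} (hφ : ContDiff ℝ ∞ φ)
    (hcrit : ∀ x ∈ K, grad φ x ≠ 0) :
    ∃ l > 0, ∃ κ : Coord m → ℝ, ContDiff ℝ ∞ κ ∧ ∃ c > 0,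
      let ψ := fun z => Real.exp (l * φ z)
      (∀ x ∈ K, ∀ ξ : Fin m → ℝ,
        c * ∑ i, ξ i ^ 2 ≤ 4 * hessForm a (flux a ψ) x ξ + 2 * κ x * qform a x ξ) ∧
      (∀ x ∈ K, c ≤ along (flux a ψ) (along (flux a ψ) ψ) x
        - κ x * along (flux a ψ) ψ x) := by
  have hac (i j) : Continuous (a i j) := (ha i j).continuous
  have hfs (k) : ContDiff ℝ ∞ (flux a φ k) := contDiff_flux ha hφ k
  have hfc (k) : Continuous (flux a φ k) := (hfs k).continuous
  have hpf (i k) : Continuous (pd i (flux a φ k)) := (contDiff_pd i (hfs k)).continuous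
  have hpa (l i j) : Continuous (pd l (a i j)) := (contDiff_pd l (ha i j)).continuous
  have hAs : ContDiff ℝ ∞ (along (flux a φ) φ) := contDiff_along hfs hφ
  obtain ⟨c₀, hc₀, h₀⟩ := exists_pos_quadratic_lower_bound hK (f := qform a)
    (by unfold qform; fun_prop) qform_smul hpos
  obtain ⟨c₁, hc₁, h₁⟩ := exists_pos_lower_bound hK (f := along (flux a φ) φ)
    hAs.continuous.continuousOn
    fun x hx => by rw [along_flux_self]; exact hpos x hx _ (hcrit x hx)
  obtain ⟨C₁, hC₁⟩ := exists_quadratic_bound hK (f := hessForm a (flux a φ))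
    (by unfold hessForm qform; fun_prop) (hessForm_smul _)
  obtain ⟨C₂, -, hC₂⟩ := exists_bound_on_compact hK
    (f := along (flux a φ) (along (flux a φ) φ)) (contDiff_along hfs hAs).continuous
  -- The second entry makes the gradient form positive despite the lower bound `-C₁|ξ|²` on the
  -- Hessian of `φ`; the third makes the `v²` coefficient positive despite `C₂`.
  obtain ⟨l, hl⟩ : ∃ l : ℝ, l = max 1 (max ((4 * C₁ + 1) / (2 * c₁ * c₀)) ((C₂ + 1) / c₁ ^ 2)) :=
    ⟨_, rfl⟩
  have hl1 : 1 ≤ l := hl ▸ le_max_left _ _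
  have hl2 : 4 * C₁ + 1 ≤ l * (2 * c₁ * c₀) := by
    rw [← div_le_iff₀ (by positivity), hl]
    exact (le_max_left _ _).trans (le_max_right _ _)
  have hl3 : C₂ + 1 ≤ l * c₁ ^ 2 := by
    rw [← div_le_iff₀ (by positivity), hl]
    exact (le_max_right _ _).trans (le_max_right _ _)
  have hl0 : 0 < l := by linarith
  obtain ⟨e₀, he₀, h_e⟩ := exists_pos_lower_bound hK (f := fun x => Real.exp (l * φ x))
    (by have := hφ.continuous; fun_prop) fun x _ => Real.exp_pos _
  -- The function `κ = l² e^{lφ} |∇φ|²` is a compromise: it supplies the positive term `2κq` of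
  -- order `l²` in the first condition and consumes only half of the leading term `2l⁴ e^{3lφ}
  -- |∇φ|⁴` in the second.
  refine ⟨l, hl0, fun z => l ^ 2 * Real.exp (l * φ z) * along (flux a φ) φ z, by fun_prop,
    min (l * e₀) (l ^ 3 * e₀ ^ 3), by positivity, ?_, ?_⟩
  · intro x hx ξ
    rw [hessForm_exp ha hsymm hφ]
    have hξ : 0 ≤ ∑ i, ξ i ^ 2 := Finset.sum_nonneg fun i _ => sq_nonneg _
    have b1 := hC₁ x hx ξ
    have b2 := h₀ x hx ξ
    have b3 := h₁ x hx
    have b4 := h_e x hx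
    set e := Real.exp (l * φ x)
    have he : 0 < e := Real.exp_pos _
    have b5 : c₁ * (c₀ * ∑ i, ξ i ^ 2) ≤ along (flux a φ) φ x * qform a x ξ :=
      mul_le_mul b3 b2 (by positivity) (by linarith)
    have b6 : ∑ i, ξ i ^ 2 ≤ 4 * hessForm a (flux a φ) x ξ
        + 2 * l * (along (flux a φ) φ x * qform a x ξ) := by
      have := mul_le_mul_of_nonneg_right hl2 hξ
      have := mul_le_mul_of_nonneg_left b5 hl0.le
      linarith
    have b7 := mul_le_mul_of_nonneg_left b6 (mul_pos hl0 he).le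
    have b8 : 0 ≤ l ^ 2 * e * (∑ k, flux a φ k x * ξ k) ^ 2 := by positivity
    have b9 : min (l * e₀) (l ^ 3 * e₀ ^ 3) * ∑ i, ξ i ^ 2 ≤ l * e * ∑ i, ξ i ^ 2 := by
      refine mul_le_mul_of_nonneg_right ((min_le_left _ _).trans ?_) hξ
      gcongr
    linarith
  · intro x hx
    obtain ⟨hA, hXA⟩ := along_exp ha hφ l x
    rw [hXA, hA]
    have b2 := (abs_le.1 (hC₂ x hx)).1
    have b3 := h₁ x hx
    have b4 := h_e x hx
    set e := Real.exp (l * φ x)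
    have he : 0 < e := Real.exp_pos _
    have b5 : c₁ ^ 2 ≤ along (flux a φ) φ x ^ 2 := by gcongr
    have b6 : 1 ≤ l * along (flux a φ) φ x ^ 2 + along (flux a φ) (along (flux a φ) φ) x := by
      have := mul_le_mul_of_nonneg_left b5 hl0.le
      linarith
    have b7 := mul_le_mul_of_nonneg_left b6 (by positivity : 0 ≤ l ^ 3 * e ^ 3)
    have b9 : min (l * e₀) (l ^ 3 * e₀ ^ 3) ≤ l ^ 3 * e ^ 3 := by
      refine (min_le_right _ _).trans ?_
      gcongr
    linarith

theorem sum_smul_coordVec (v : Coord m) : ∑ i, v i • coordVec i = v := by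
  ext j
  simp [coordVec, Pi.single_apply]

theorem clm_apply_eq_sum {W : Type*} [NormedAddCommGroup W] [NormedSpace ℝ W]
    (L : Coord m →L[ℝ] W) (v : Coord m) : L v = ∑ i, v i • L (coordVec i) := by
  conv_lhs => rw [← sum_smul_coordVec v]
  simp

/-- The derivative in the radial direction `x - q` is `-2‖x - q‖²`. -/
theorem grad_neg_norm_sq_ne_zero {q x : Coord m} (hx : x ≠ q) :
    grad (fun z => -‖z - q‖ ^ 2) x ≠ 0 := by
  intro h
  have hd : HasFDerivAt (fun z : Coord m => -‖z - q‖ ^ 2)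
      (-(2 • (innerSL ℝ (x - q)).comp (ContinuousLinearMap.id ℝ (Coord m)))) x :=
    (((hasFDerivAt_id x).sub_const q).norm_sq).neg
  have h1 := clm_apply_eq_sum (fderiv ℝ (fun z : Coord m => -‖z - q‖ ^ 2) x) (x - q)
  have h2 (i : Fin m) : fderiv ℝ (fun z : Coord m => -‖z - q‖ ^ 2) x (coordVec i) = 0 :=
    congrFun h i
  simp only [h2, smul_zero, Finset.sum_const_zero] at h1
  rw [hd.fderiv] at h1
  simp only [neg_apply, smul_apply, ContinuousLinearMap.comp_id, innerSL_apply_apply,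
    real_inner_self_eq_norm_sq, neg_eq_zero, smul_eq_zero] at h1
  have : ‖x - q‖ ≠ 0 := norm_ne_zero_iff.2 (sub_ne_zero.2 hx)
  simp_all

/-- Unique continuation across spheres, for functions supported in an annulus. -/
theorem eq_zero_of_divOp_le_of_annulus {ι : Type*} [Fintype ι] (ha : ∀ i j, ContDiff ℝ ∞ (a i j))
    (hsymm : ∀ i j x, a i j x = a j i x) {q : Coord m} {r ρ R : ℝ} (hr : 0 < r) (hρ : 0 < ρ)
    (hpos : ∀ x ∈ Metric.closedBall q R, ∀ ξ ≠ 0, 0 < qform a x ξ) {w : ι → Coord m → ℝ}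
    (hw : ∀ k, ContDiff ℝ ∞ (w k))
    (hsupp : ∀ k, tsupport (w k) ⊆ Metric.closedBall q R \ Metric.ball q r) {C : ℝ} (hC : 0 ≤ C)
    (hle : ∀ x ∈ Metric.ball q ρ, ∑ k, divOp a (w k) x ^ 2
      ≤ C * ∑ k, (w k x ^ 2 + ∑ i, pd i (w k) x ^ 2)) :
    ∀ x ∈ Metric.ball q ρ, ∀ k, w k x = 0 := by
  set K := Metric.closedBall q R \ Metric.ball q r with hKdef
  have hK : IsCompact K := (isCompact_closedBall q R).diff Metric.isOpen_ball
  set φ : Coord m → ℝ := fun z => -‖z - q‖ ^ 2 with hφdef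
  have hφ : ContDiff ℝ ∞ φ := ((contDiff_id.sub contDiff_const).norm_sq ℝ).neg
  obtain ⟨l, hl, κ, hκ, c, hc, h1, h2⟩ := exists_carleman_weight ha hsymm hK
    (fun x hx => hpos x hx.1) hφ fun x hx => grad_neg_norm_sq_ne_zero fun h => hx.2 (by simpa [h] using hr)
  set ψ : Coord m → ℝ := fun z => Real.exp (l * φ z) with hψdef
  have hψ : ContDiff ℝ ∞ ψ := by fun_prop
  obtain ⟨s, hs, t₀, ht₀, hcar⟩ := carleman_estimate ha hsymm hψ hκ hK hc h1 h2
  -- The value of `ψ` on the sphere of radius `ρ`. The weight decreases radially, so `ψ ≥ ψ₀`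
  -- inside, where the differential inequality holds, and `ψ ≤ ψ₀` outside, where nothing is known
  -- about `divOp`.
  set ψ₀ : ℝ := Real.exp (l * -ρ ^ 2) with hψ₀
  have hwc (k) : HasCompactSupport (w k) := hK.of_isClosed_subset (isClosed_tsupport _) (hsupp k)
  have hw0 (k) {x : Coord m} (hx : x ∉ tsupport (w k)) : w k x = 0 :=
    image_eq_zero_of_notMem_tsupport hx
  have hpw0 (k) (i) {x : Coord m} (hx : x ∉ tsupport (w k)) : pd i (w k) x = 0 :=
    pd_eq_zero_of_notMem_tsupport i hx
  have hL0 (k) {x : Coord m} (hx : x ∉ tsupport (w k)) : divOp a (w k) x = 0 := by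
    refine Finset.sum_eq_zero fun i _ => pd_eq_zero_of_notMem_tsupport i fun h => hx ?_
    refine closure_minimal (fun y hy => ?_) (isClosed_tsupport (w k)) h
    by_contra hy'
    exact hy (by simp [flux, hpw0 k _ hy'])
  have hint {f : Coord m → ℝ} (hf : ContDiff ℝ ∞ f) (k : ι)
      (h0 : ∀ x ∉ tsupport (w k), f x = 0) : Integrable f :=
    hf.continuous.integrable_of_hasCompactSupport (HasCompactSupport.intro (hwc k).isCompact h0)
  have hi1 (t : ℝ) (k) : Integrable fun x =>
      Real.exp (t * ψ x) ^ 2 * (t * ∑ i, pd i (w k) x ^ 2 + t ^ 3 * w k x ^ 2) :=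
    hint (by fun_prop) k fun x hx => by simp [hw0 k hx, hpw0 k _ hx]
  have hi2 (t : ℝ) (k) : Integrable fun x => Real.exp (t * ψ x) ^ 2 * divOp a (w k) x ^ 2 :=
    hint (by fun_prop) k fun x hx => by simp [hL0 k hx]
  have hi3 (t : ℝ) (k) : Integrable fun x =>
      Real.exp (t * ψ x) ^ 2 * (w k x ^ 2 + ∑ i, pd i (w k) x ^ 2) :=
    hint (by fun_prop) k fun x hx => by simp [hw0 k hx, hpw0 k _ hx]
  have hi4 (k) : Integrable fun x => divOp a (w k) x ^ 2 :=
    hint (by fun_prop) k fun x hx => by simp [hL0 k hx]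
  have hi5 (k) : Integrable fun x => w k x ^ 2 :=
    hint (by fun_prop) k fun x hx => by simp [hw0 k hx]
  set H : ℝ := ∑ k, ∫ x, divOp a (w k) x ^ 2 with hH
  set J : ℝ := ∑ k, ∫ x in Metric.ball q ρ, w k x ^ 2 with hJ
  have hJ0 : 0 ≤ J := Finset.sum_nonneg fun k _ => integral_nonneg fun x => sq_nonneg _
  -- The lower order terms are absorbed once `st ≥ 2C`. The contribution from outside the ball
  -- carries at most the factor `e^{2tψ₀}`, while `J` carries at least that factor, so the
  -- exponentials cancel. The resulting bound on `tJ` is uniform in `t`, which forces `J = 0`.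
  have hmain (t : ℝ) (ht : t₀ ≤ t) (htC : 2 * C ≤ s * t) : s * t * J ≤ 2 * H := by
    have ht1 : 1 ≤ t := ht₀.trans ht
    set E : ℝ := ∑ k, ∫ x, Real.exp (t * ψ x) ^ 2 * (w k x ^ 2 + ∑ i, pd i (w k) x ^ 2) with hE
    have e1 : s * t * E ≤ ∑ k, ∫ x, Real.exp (t * ψ x) ^ 2 * divOp a (w k) x ^ 2 := by
      rw [hE, Finset.mul_sum]
      refine Finset.sum_le_sum fun k _ => ?_
      refine le_trans ?_ (hcar t ht (w k) (hw k) (hsupp k))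
      rw [mul_assoc, ← integral_const_mul]
      refine mul_le_mul_of_nonneg_left ?_ hs.le
      refine integral_mono ((hi3 t k).const_mul t) (hi1 t k) fun x => ?_
      have : t ≤ t ^ 3 := le_self_pow₀ ht1 (by norm_num)
      have := mul_le_mul_of_nonneg_right this (sq_nonneg (w k x))
      calc t * (Real.exp (t * ψ x) ^ 2 * (w k x ^ 2 + ∑ i, pd i (w k) x ^ 2))
          = Real.exp (t * ψ x) ^ 2 * (t * ∑ i, pd i (w k) x ^ 2 + t * w k x ^ 2) := by ring
        _ ≤ _ := by gcongr
    have e2 : ∑ k, ∫ x, Real.exp (t * ψ x) ^ 2 * divOp a (w k) x ^ 2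
        ≤ C * E + Real.exp (t * ψ₀) ^ 2 * H := by
      rw [hE, hH, ← integral_finsetSum _ fun k _ => hi2 t k,
        ← integral_finsetSum _ fun k _ => hi3 t k, ← integral_finsetSum _ fun k _ => hi4 k,
        ← integral_const_mul, ← integral_const_mul, ← integral_add
          ((integrable_finsetSum _ fun k _ => hi3 t k).const_mul _)
          ((integrable_finsetSum _ fun k _ => hi4 k).const_mul _)]
      refine integral_mono (integrable_finsetSum _ fun k _ => hi2 t k)
        (((integrable_finsetSum _ fun k _ => hi3 t k).const_mul _).add
          ((integrable_finsetSum _ fun k _ => hi4 k).const_mul _)) fun x => ?_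
      simp only [← Finset.mul_sum]
      have n1 : 0 ≤ ∑ k, divOp a (w k) x ^ 2 := Finset.sum_nonneg fun k _ => sq_nonneg _
      have n2 : 0 ≤ ∑ k, (w k x ^ 2 + ∑ i, pd i (w k) x ^ 2) := by positivity
      by_cases hx : x ∈ Metric.ball q ρ
      · have := mul_le_mul_of_nonneg_left (hle x hx) (sq_nonneg (Real.exp (t * ψ x)))
        have : 0 ≤ Real.exp (t * ψ₀) ^ 2 * ∑ k, divOp a (w k) x ^ 2 := by positivity
        linarith
      · have hψx : ψ x ≤ ψ₀ := by
          rw [hψ₀, hψdef]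
          refine Real.exp_le_exp.2 (mul_le_mul_of_nonneg_left (neg_le_neg ?_) hl.le)
          rw [Metric.mem_ball, not_lt, dist_eq_norm] at hx
          gcongr
        have : Real.exp (t * ψ x) ^ 2 * ∑ k, divOp a (w k) x ^ 2
            ≤ Real.exp (t * ψ₀) ^ 2 * ∑ k, divOp a (w k) x ^ 2 := by gcongr
        have : 0 ≤ C * (Real.exp (t * ψ x) ^ 2 * ∑ k, (w k x ^ 2 + ∑ i, pd i (w k) x ^ 2)) := by
          positivity
        linarith
    have e3 : Real.exp (t * ψ₀) ^ 2 * J ≤ E := by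
      rw [hJ, hE, Finset.mul_sum]
      refine Finset.sum_le_sum fun k _ => ?_
      rw [← integral_const_mul]
      refine le_trans (setIntegral_mono_on ((hi5 k).const_mul _).integrableOn (hi3 t k).integrableOn
        Metric.isOpen_ball.measurableSet fun x hx => ?_)
        (setIntegral_le_integral (hi3 t k) (Filter.Eventually.of_forall fun x => by
          simp only [Pi.zero_apply]; positivity))
      have hψx : ψ₀ ≤ ψ x := by
        rw [hψ₀, hψdef]
        refine Real.exp_le_exp.2 (mul_le_mul_of_nonneg_left (neg_le_neg ?_) hl.le)
        rw [Metric.mem_ball, dist_eq_norm] at hx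
        gcongr
      have : w k x ^ 2 ≤ w k x ^ 2 + ∑ i, pd i (w k) x ^ 2 :=
        le_add_of_nonneg_right (Finset.sum_nonneg fun i _ => sq_nonneg _)
      gcongr
    have hE0 : 0 ≤ E := by positivity
    have e4 : s * t * E ≤ 2 * (Real.exp (t * ψ₀) ^ 2 * H) := by nlinarith
    have hst : 0 ≤ s * t := by positivity
    have e5 : Real.exp (t * ψ₀) ^ 2 * (s * t * J) ≤ Real.exp (t * ψ₀) ^ 2 * (2 * H) := by
      have := mul_le_mul_of_nonneg_left e3 hst
      linarith
    exact le_of_mul_le_mul_left e5 (by positivity)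
  have hJz : J = 0 := by
    by_contra hne
    have hJp : 0 < J := lt_of_le_of_ne hJ0 (Ne.symm hne)
    have := hmain (max t₀ (max (2 * C / s) ((2 * H + 1) / (s * J)))) (le_max_left _ _) (by
      rw [mul_comm s, ← div_le_iff₀ hs]
      exact (le_max_left _ _).trans (le_max_right _ _))
    have h3 : 2 * H + 1 ≤ max t₀ (max (2 * C / s) ((2 * H + 1) / (s * J))) * (s * J) := by
      rw [← div_le_iff₀ (by positivity)]
      exact (le_max_right _ _).trans (le_max_right _ _)
    linarith
  intro x hx k
  have hJk : ∫ x in Metric.ball q ρ, w k x ^ 2 = 0 :=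
    (Finset.sum_eq_zero_iff_of_nonneg fun k _ => integral_nonneg fun x => sq_nonneg _).1
      (hJ ▸ hJz) k (Finset.mem_univ k)
  rw [setIntegral_eq_zero_iff_of_nonneg_ae (Filter.Eventually.of_forall fun x => sq_nonneg _)
    (hi5 k).integrableOn] at hJk
  have := Measure.eqOn_open_of_ae_eq hJk Metric.isOpen_ball
    ((hw k).continuous.pow 2).continuousOn continuousOn_const hx
  simpa using this

end UniqueContinuation

/-! ### Local unique continuation for elliptic systems with scalar principal part. -/

section LocalUniqueContinuation

open Filter Topology

variable {m n : ℕ}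

/-- The divergence and nondivergence forms differ only by first order terms, which a differential
inequality of the present type can absorb. -/
theorem divOp_eq_sum {a : Fin m → Fin m → Coord m → ℝ} (ha : ∀ i j, ContDiff ℝ ∞ (a i j))
    {v : Coord m → ℝ} (hv : ContDiff ℝ ∞ v) (x : Coord m) :
    divOp a v x = ∑ i, ∑ j, a i j x * pd i (pd j v) x + ∑ j, pd j v x * ∑ i, pd i (a i j) x := by
  have h1 (i : Fin m) : pd i (flux a v i) x
      = ∑ j, (a i j x * pd i (pd j v) x + pd j v x * pd i (a i j) x) := by
    have : flux a v i = fun z => ∑ j, a i j z * pd j v z := rfl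
    rw [this, pd_sum _ _ fun k => by fun_prop]
    refine Finset.sum_congr rfl fun j _ => ?_
    rw [pd_mul _ (ha i j) (by fun_prop)]; ring
  rw [divOp]
  simp only [h1, Finset.sum_add_distrib, Finset.mul_sum]
  congr 1
  exact Finset.sum_comm

/-- The operator norm is at most the Hilbert–Schmidt norm, by Cauchy–Schwarz. -/
theorem norm_sq_le_sum_norm_sq_apply {W : Type*} [NormedAddCommGroup W] [NormedSpace ℝ W]
    (L : Coord m →L[ℝ] W) : ‖L‖ ^ 2 ≤ ∑ i, ‖L (coordVec i)‖ ^ 2 := by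
  have h0 : 0 ≤ ∑ i, ‖L (coordVec i)‖ ^ 2 := by positivity
  rw [← Real.sq_sqrt h0]
  refine pow_le_pow_left₀ (norm_nonneg _) (L.opNorm_le_bound (Real.sqrt_nonneg _) fun v => ?_) 2
  rw [clm_apply_eq_sum L v]
  refine (norm_sum_le _ _).trans ?_
  rw [EuclideanSpace.norm_eq, mul_comm, ← Real.sqrt_mul (by positivity)]
  refine Real.le_sqrt_of_sq_le ?_
  simp only [norm_smul]
  exact Finset.sum_mul_sq_le_sq_mul_sq _ _ _

theorem contDiff_mul_of_tsupport_subset {Ω : Set (Coord m)} (hΩ : IsOpen Ω) {χ f : Coord m → ℝ}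
    (hχ : ContDiff ℝ ∞ χ) (hs : tsupport χ ⊆ Ω) (hf : ContDiffOn ℝ ∞ f Ω) :
    ContDiff ℝ ∞ fun x => χ x * f x := by
  rw [contDiff_iff_contDiffAt]
  intro x
  by_cases hx : x ∈ Ω
  · exact hχ.contDiffAt.mul (hf.contDiffAt (hΩ.mem_nhds hx))
  · have : (fun x => χ x * f x) =ᶠ[𝓝 x] fun _ => 0 := by
      filter_upwards [notMem_tsupport_iff_eventuallyEq.1 fun h => hx (hs h)] with y hy
      simp [hy]
    exact contDiffAt_const.congr_of_eventuallyEq this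

theorem pd_congr {f g : Coord m → ℝ} {x : Coord m} (h : f =ᶠ[𝓝 x] g) (i : Fin m) :
    pd i f =ᶠ[𝓝 x] pd i g := by
  filter_upwards [h.fderiv (𝕜 := ℝ)] with y hy
  rw [pd, pd, hy]

theorem pd_component {V : Coord m → Coord n} {x : Coord m} (hV : DifferentiableAt ℝ V x)
    (i : Fin m) (k : Fin n) : pd i (fun z => V z k) x = fderiv ℝ V x (coordVec i) k := by
  have := ((EuclideanSpace.proj k : Coord n →L[ℝ] ℝ).hasFDerivAt.comp x hV.hasFDerivAt).fderiv
  have e : (EuclideanSpace.proj k : Coord n →L[ℝ] ℝ) ∘ V = fun z => V z k := by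
    funext z; simp
  rw [e] at this
  rw [pd, this]
  simp

/-- Unique continuation for second order elliptic systems with scalar principal part: a solution
vanishing on a small ball vanishes on every larger concentric ball. -/
theorem eq_zero_of_elliptic_inequality {Ω : Set (Coord m)} (hΩ : IsOpen Ω)
    {a : Fin m → Fin m → Coord m → ℝ} (ha : ∀ i j, ContDiffOn ℝ ∞ (a i j) Ω)
    (hsymm : ∀ i j, ∀ x ∈ Ω, a i j x = a j i x) (hpos : ∀ x ∈ Ω, ∀ ξ ≠ 0, 0 < qform a x ξ)
    {V : Coord m → Coord n} (hV : ContDiffOn ℝ ∞ V Ω) {q : Coord m} {r ρ R R' : ℝ} (hr : 0 < r)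
    (hρ : 0 < ρ) (hR : ρ < R) (hR' : R < R') (hball : Metric.closedBall q R' ⊆ Ω) {C : ℝ}
    (hle : ∀ x ∈ Metric.ball q ρ,
      ‖∑ i, ∑ j, a i j x • fderiv ℝ (fun z => fderiv ℝ V z (coordVec j)) x (coordVec i)‖
        ≤ C * (‖V x‖ + ‖fderiv ℝ V x‖))
    (hzero : ∀ x ∈ Metric.ball q r, V x = 0) :
    ∀ x ∈ Metric.ball q ρ, V x = 0 := by
  -- The Carleman estimate needs globally smooth coefficients and compactly supported functions. The
  -- cut-off `χ₁` extends the coefficients and equals 1 on the ball of radius `R`; `χ₂` cuts off the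
  -- solution inside that ball and equals 1 on the ball of radius `ρ`, so nothing changes where the
  -- inequality is used.
  let χ₁ : ContDiffBump q := ⟨R, R', hρ.trans hR, hR'⟩
  let χ₂ : ContDiffBump q := ⟨ρ, R, hρ, hR⟩
  have hRΩ : Metric.closedBall q R ⊆ Ω := (Metric.closedBall_subset_closedBall hR'.le).trans hball
  have hρR : Metric.ball q ρ ⊆ Metric.closedBall q R :=
    Metric.ball_subset_closedBall.trans (Metric.closedBall_subset_closedBall hR.le)
  set b : Fin m → Fin m → Coord m → ℝ := fun i j x => χ₁ x * a i j x with hb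
  set w : Fin n → Coord m → ℝ := fun k x => χ₂ x * V x k with hw
  have hVk (k) : ContDiffOn ℝ ∞ (fun x => V x k) Ω := by
    have := (contDiffOn_piLp (p := 2)).1 hV k
    exact this
  have hbs (i j) : ContDiff ℝ ∞ (b i j) :=
    contDiff_mul_of_tsupport_subset hΩ χ₁.contDiff (χ₁.tsupport_eq ▸ hball) (ha i j)
  have hws (k) : ContDiff ℝ ∞ (w k) :=
    contDiff_mul_of_tsupport_subset hΩ χ₂.contDiff (χ₂.tsupport_eq ▸ hRΩ) (hVk k)
  have hbsymm (i j x) : b i j x = b j i x := by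
    by_cases hx : x ∈ Ω
    · simp only [hb, hsymm i j x hx]
    · have : χ₁ x = 0 := image_eq_zero_of_notMem_tsupport fun h => hx (hball (χ₁.tsupport_eq ▸ h))
      simp only [hb, this, zero_mul]
  have hba {x} (hx : x ∈ Metric.closedBall q R) (i j) : b i j x = a i j x := by
    simp only [hb]
    rw [χ₁.one_of_mem_closedBall hx, one_mul]
  have hbpos : ∀ x ∈ Metric.closedBall q R, ∀ ξ ≠ 0, 0 < qform b x ξ := by
    intro x hx ξ hξ
    have := hpos x (hRΩ hx) ξ hξ
    simpa only [qform, hba hx] using this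
  have hsupp (k) : tsupport (w k) ⊆ Metric.closedBall q R \ Metric.ball q r := by
    have h1 : tsupport (w k) ⊆ Metric.closedBall q R := by
      have : tsupport (w k) ⊆ tsupport χ₂ := tsupport_mul_subset_left
      rwa [χ₂.tsupport_eq] at this
    refine fun x hx => ⟨h1 hx, fun hxr => ?_⟩
    refine notMem_tsupport_iff_eventuallyEq.2 ?_ hx
    filter_upwards [Metric.isOpen_ball.mem_nhds hxr] with y hy
    simp [hw, hzero y hy]
  have hwV {x} (hx : x ∈ Metric.ball q ρ) (k) : w k =ᶠ[𝓝 x] fun z => V z k := by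
    filter_upwards [Metric.isOpen_ball.mem_nhds hx] with y hy
    simp only [hw]
    rw [χ₂.one_of_mem_closedBall (Metric.ball_subset_closedBall hy), one_mul]
  have hVat {x} (hx : x ∈ Metric.ball q ρ) : ContDiffAt ℝ ∞ V x :=
    hV.contDiffAt (hΩ.mem_nhds (hRΩ (hρR hx)))
  have hpdw {x} (hx : x ∈ Metric.ball q ρ) (i k) :
      pd i (w k) x = fderiv ℝ V x (coordVec i) k := by
    rw [(pd_congr (hwV hx k) i).self_of_nhds,
      pd_component ((hVat hx).differentiableAt (by simp))]
  have hppw {x} (hx : x ∈ Metric.ball q ρ) (i j k) : pd i (pd j (w k)) x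
      = fderiv ℝ (fun z => fderiv ℝ V z (coordVec j)) x (coordVec i) k := by
    have : pd j (w k) =ᶠ[𝓝 x] fun z => fderiv ℝ V z (coordVec j) k := by
      filter_upwards [Metric.isOpen_ball.mem_nhds hx] with y hy
      exact hpdw hy j k
    have hd : ContDiffAt ℝ ∞ (fderiv ℝ V) x := (hVat hx).fderiv_right (by simp)
    rw [(pd_congr this i).self_of_nhds,
      pd_component ((hd.clm_apply contDiffAt_const).differentiableAt (by simp))]
  obtain ⟨B, hB1, hB⟩ := exists_bound_on_compact (isCompact_closedBall q R)
    (f := fun x => ∑ j, (∑ i, pd i (b i j) x) ^ 2)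
    (ContDiff.continuous (n := ∞) (by fun_prop))
  have hmain := eq_zero_of_divOp_le_of_annulus hbs hbsymm hr hρ hbpos hws hsupp
    -- The bound `C(|V| + |∂V|)` squares to at most `2C²(|V|² + |∂V|²)`, doubled when the first
    -- order terms are split off; `2B` accounts for those terms, which involve the derivatives of
    -- the coefficients.
    (C := 4 * C ^ 2 + 2 * B) (by positivity) (by
      intro x hx
      have hxR := hρR hx
      have hVn : ‖V x‖ ^ 2 = ∑ k, w k x ^ 2 := by
        rw [EuclideanSpace.real_norm_sq_eq]
        exact Finset.sum_congr rfl fun k _ => by rw [(hwV hx k).self_of_nhds]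
      have hDn : ‖fderiv ℝ V x‖ ^ 2 ≤ ∑ k, ∑ i, pd i (w k) x ^ 2 := by
        refine (norm_sq_le_sum_norm_sq_apply _).trans (le_of_eq ?_)
        rw [Finset.sum_comm]
        refine Finset.sum_congr rfl fun i _ => ?_
        rw [EuclideanSpace.real_norm_sq_eq]
        exact Finset.sum_congr rfl fun k _ => by rw [hpdw hx]
      set S := ∑ i, ∑ j, a i j x • fderiv ℝ (fun z => fderiv ℝ V z (coordVec j)) x (coordVec i)
        with hS
      have hSk (k) : divOp b (w k) x = S k + ∑ j, pd j (w k) x * ∑ i, pd i (b i j) x := by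
        rw [divOp_eq_sum hbs (hws k)]
        congr 1
        simp [hS, hba hxR, hppw hx]
      have h1 (k) : divOp b (w k) x ^ 2 ≤ 2 * S k ^ 2 + 2 * (B * ∑ j, pd j (w k) x ^ 2) := by
        have := sq_sum_le_bound (ξ := fun j => pd j (w k) x)
          ((le_abs_self _).trans (hB x hxR))
        rw [hSk]
        nlinarith [sq_nonneg (S k - ∑ j, pd j (w k) x * ∑ i, pd i (b i j) x)]
      have h2 : ∑ k, S k ^ 2 ≤ 2 * C ^ 2 * (‖V x‖ ^ 2 + ‖fderiv ℝ V x‖ ^ 2) := by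
        rw [← EuclideanSpace.real_norm_sq_eq]
        have h3 := pow_le_pow_left₀ (norm_nonneg _) (hle x hx) 2
        refine h3.trans ?_
        nlinarith [mul_nonneg (sq_nonneg C) (sq_nonneg (‖V x‖ - ‖fderiv ℝ V x‖))]
      have h4 : ∑ k, divOp b (w k) x ^ 2
          ≤ 2 * ∑ k, S k ^ 2 + 2 * (B * ∑ k, ∑ j, pd j (w k) x ^ 2) := by
        refine (Finset.sum_le_sum fun k _ => h1 k).trans (le_of_eq ?_)
        simp only [Finset.sum_add_distrib, Finset.mul_sum]
      rw [Finset.sum_add_distrib, ← hVn]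
      have h5 : 0 ≤ B * ‖V x‖ ^ 2 := by positivity
      have h6 := mul_le_mul_of_nonneg_left hDn (by positivity : 0 ≤ 4 * C ^ 2)
      linarith)
  intro x hx
  ext k
  have := hmain x hx k
  rw [(hwV hx k).self_of_nhds] at this
  simpa using this

end LocalUniqueContinuation

/-! ### Inner products, their Gram matrices and metric traces. -/

section InnerProducts

variable {m : ℕ}

/-- A bilinear form is an inner product. -/
structure IsInner (B : Coord m →L[ℝ] Coord m →L[ℝ] ℝ) : Prop where
  symm : ∀ v w, B v w = B w v
  pos : ∀ v, v ≠ 0 → 0 < B v v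

theorem IsInner.ext_right {B : Coord m →L[ℝ] Coord m →L[ℝ] ℝ} (hB : IsInner B) {u v : Coord m}
    (h : ∀ l, B u l = B v l) : u = v := by
  by_contra hne
  have := hB.pos (u - v) (sub_ne_zero.2 hne)
  have h0 : B (u - v) (u - v) = 0 := by
    rw [map_sub B, sub_apply, h, sub_self]
  exact this.ne' h0

/-- The Gram matrix of a bilinear form. -/
def gram (B : Coord m →L[ℝ] Coord m →L[ℝ] ℝ) : Matrix (Fin m) (Fin m) ℝ :=
  Matrix.of fun i j => B (coordVec i) (coordVec j)

theorem inverseMetric_eq (G : Coord m → Coord m →L[ℝ] Coord m →L[ℝ] ℝ) (x : Coord m) :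
    inverseMetric G x = (gram (G x))⁻¹ := rfl

theorem apply_eq_sum_gram (B : Coord m →L[ℝ] Coord m →L[ℝ] ℝ) (v w : Coord m) :
    B v w = ∑ i, ∑ j, v i * w j * gram B i j := by
  rw [clm_apply_eq_sum B v, sum_apply]
  refine Finset.sum_congr rfl fun i _ => ?_
  rw [smul_apply, clm_apply_eq_sum (B (coordVec i)) w, smul_eq_mul, Finset.mul_sum]
  exact Finset.sum_congr rfl fun j _ => by rw [gram, Matrix.of_apply, smul_eq_mul]; ring

theorem IsInner.isUnit_det {B : Coord m →L[ℝ] Coord m →L[ℝ] ℝ} (hB : IsInner B) :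
    IsUnit (gram B).det := by
  rw [isUnit_iff_ne_zero]
  intro h
  obtain ⟨v, hv, h0⟩ := Matrix.exists_mulVec_eq_zero_iff.2 h
  have hv' : (WithLp.toLp 2 v : Coord m) ≠ 0 := fun h => hv (by
    funext i; exact congrArg (fun z : Coord m => z i) h)
  have hpos := hB.pos _ hv'
  rw [apply_eq_sum_gram] at hpos
  have : ∑ i, v i * ∑ j, gram B i j * v j = 0 := by
    refine Finset.sum_eq_zero fun i _ => ?_
    have := congrFun h0 i
    simp only [Matrix.mulVec, dotProduct, Pi.zero_apply] at this
    rw [this, mul_zero]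
  refine hpos.ne' ?_
  rw [← this]
  refine Finset.sum_congr rfl fun i _ => ?_
  rw [Finset.mul_sum]
  exact Finset.sum_congr rfl fun j _ => by ring

theorem IsInner.gram_transpose {B : Coord m →L[ℝ] Coord m →L[ℝ] ℝ} (hB : IsInner B) :
    (gram B).transpose = gram B := by
  ext i j
  exact hB.symm _ _

theorem IsInner.inv_gram_symm {B : Coord m →L[ℝ] Coord m →L[ℝ] ℝ} (hB : IsInner B)
    (i j : Fin m) : (gram B)⁻¹ i j = (gram B)⁻¹ j i := by
  have := Matrix.transpose_nonsing_inv (gram B)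
  rw [hB.gram_transpose] at this
  exact congrFun (congrFun this j) i

/-- The vector with components `∑ⱼ g^{ij} αⱼ`. -/
def sharp (B : Coord m →L[ℝ] Coord m →L[ℝ] ℝ) (α : Fin m → ℝ) : Coord m :=
  ∑ i, (∑ j, (gram B)⁻¹ i j * α j) • coordVec i

theorem sharp_apply (B : Coord m →L[ℝ] Coord m →L[ℝ] ℝ) (α : Fin m → ℝ) (i : Fin m) :
    sharp B α i = ∑ j, (gram B)⁻¹ i j * α j := by
  simp [sharp, coordVec, Pi.single_apply]

theorem IsInner.apply_sharp {B : Coord m →L[ℝ] Coord m →L[ℝ] ℝ} (hB : IsInner B)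
    (α : Fin m → ℝ) (l : Fin m) : B (sharp B α) (coordVec l) = α l := by
  have h1 : B (sharp B α) (coordVec l) = ∑ i, gram B l i * ∑ j, (gram B)⁻¹ i j * α j := by
    rw [sharp, map_sum, sum_apply]
    refine Finset.sum_congr rfl fun i _ => ?_
    rw [map_smul, smul_apply, smul_eq_mul, mul_comm, hB.symm]; rfl
  have h2 := congrFun (Matrix.mulVec_mulVec α (gram B) (gram B)⁻¹) l
  rw [Matrix.mul_nonsing_inv _ hB.isUnit_det, Matrix.one_mulVec] at h2
  rw [h1, ← h2]
  rfl

theorem IsInner.apply_sharp_clm {B : Coord m →L[ℝ] Coord m →L[ℝ] ℝ} (hB : IsInner B)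
    (α : Coord m →L[ℝ] ℝ) (l : Coord m) : B (sharp B fun j => α (coordVec j)) l = α l := by
  rw [clm_apply_eq_sum _ l, clm_apply_eq_sum α l]
  simp only [hB.apply_sharp]

theorem IsInner.sharp_eq {B : Coord m →L[ℝ] Coord m →L[ℝ] ℝ} (hB : IsInner B) {u : Coord m}
    {α : Fin m → ℝ} (h : ∀ j, B u (coordVec j) = α j) : sharp B α = u := by
  refine hB.ext_right fun l => ?_
  rw [clm_apply_eq_sum _ l, clm_apply_eq_sum (B u) l]
  simp only [hB.apply_sharp, h]

/-- The sum is the squared length `B(ξ♯, ξ♯)` of the vector obtained by raising the index of `ξ`.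
This is the ellipticity of `g^{ij} ∂ᵢ∂ⱼ`. -/
theorem IsInner.inv_gram_pos {B : Coord m →L[ℝ] Coord m →L[ℝ] ℝ} (hB : IsInner B)
    {ξ : Fin m → ℝ} (hξ : ξ ≠ 0) : 0 < ∑ i, ∑ j, (gram B)⁻¹ i j * ξ i * ξ j := by
  have h0 : sharp B ξ ≠ 0 := fun h => hξ (by
    funext l
    rw [← hB.apply_sharp ξ l, h, map_zero]; rfl)
  have := hB.pos _ h0
  rw [clm_apply_eq_sum (B _)] at this
  simp only [hB.apply_sharp, sharp_apply, smul_eq_mul, Finset.sum_mul] at this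
  refine this.trans_eq (Finset.sum_congr rfl fun i _ => Finset.sum_congr rfl fun j _ => ?_)
  ring

theorem sharp_add (B : Coord m →L[ℝ] Coord m →L[ℝ] ℝ) (α β : Fin m → ℝ) :
    sharp B (α + β) = sharp B α + sharp B β := by
  ext i
  simp only [PiLp.add_apply, sharp_apply, Pi.add_apply, mul_add, Finset.sum_add_distrib]

theorem sharp_smul (B : Coord m →L[ℝ] Coord m →L[ℝ] ℝ) (c : ℝ) (α : Fin m → ℝ) :
    sharp B (c • α) = c • sharp B α := by
  ext i
  simp only [PiLp.smul_apply, sharp_apply, Pi.smul_apply, smul_eq_mul, Finset.mul_sum]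
  exact Finset.sum_congr rfl fun j _ => by ring

theorem metricTrace_sub {W : Type*} [AddCommGroup W] [Module ℝ W]
    (G : Coord m → Coord m →L[ℝ] Coord m →L[ℝ] ℝ) (x : Coord m) (S T : Coord m → Coord m → W) :
    metricTrace G x (fun v w => S v w - T v w) = metricTrace G x S - metricTrace G x T := by
  simp only [metricTrace, smul_sub, Finset.sum_sub_distrib]

theorem map_metricTrace {W W' : Type*} [AddCommGroup W] [Module ℝ W] [AddCommGroup W']
    [Module ℝ W'] (L : W →ₗ[ℝ] W') (G : Coord m → Coord m →L[ℝ] Coord m →L[ℝ] ℝ) (x : Coord m)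
    (T : Coord m → Coord m → W) :
    L (metricTrace G x T) = metricTrace G x fun v w => L (T v w) := by
  simp only [metricTrace, map_sum, map_smul]

/-- The metric trace is natural under linear isometries. -/
theorem metricTrace_comp {W : Type*} [NormedAddCommGroup W] [NormedSpace ℝ W]
    {G G' : Coord m → Coord m →L[ℝ] Coord m →L[ℝ] ℝ} {x y : Coord m}
    (hG' : IsInner (G' y)) (P : Coord m →L[ℝ] Coord m)
    (hP : ∀ v w, G' y v w = G x (P v) (P w)) (T : Coord m →L[ℝ] Coord m →L[ℝ] W) :
    metricTrace G' y (fun v w => T (P v) (P w)) = metricTrace G x fun v w => T v w := by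
  set Q : Matrix (Fin m) (Fin m) ℝ := Matrix.of fun i j => P (coordVec j) i with hQ
  have hgram : gram (G' y) = Q.transpose * gram (G x) * Q := by
    ext i j
    rw [Matrix.mul_apply]
    simp only [gram, Matrix.of_apply, hP, Matrix.mul_apply, Matrix.transpose_apply, hQ]
    rw [apply_eq_sum_gram, Finset.sum_comm]
    simp only [gram, Matrix.of_apply, Finset.sum_mul]
    exact Finset.sum_congr rfl fun i _ => Finset.sum_congr rfl fun j _ => by ring
  -- Invertibility of `P` is not assumed: it follows from the nondegeneracy of the pulled back form.
  have hdet : IsUnit Q.det := by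
    have := hG'.isUnit_det
    rw [hgram, Matrix.det_mul] at this
    exact isUnit_of_mul_isUnit_right this
  have hdet' : IsUnit Q.transpose.det := by rwa [Matrix.det_transpose]
  have hinv : (gram (G x))⁻¹ = Q * (gram (G' y))⁻¹ * Q.transpose := by
    rw [hgram, Matrix.mul_inv_rev, Matrix.mul_inv_rev, ← Matrix.mul_assoc,
      Matrix.mul_nonsing_inv _ hdet, Matrix.one_mul, Matrix.mul_assoc,
      Matrix.nonsing_inv_mul _ hdet', Matrix.mul_one]
  have hPe (i : Fin m) : P (coordVec i) = ∑ k, Q k i • coordVec k :=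
    (sum_smul_coordVec _).symm
  have h1 (k l : Fin m) : (gram (G x))⁻¹ k l
      = ∑ i, ∑ j, (gram (G' y))⁻¹ i j * Q k i * Q l j := by
    rw [hinv, Matrix.mul_apply, Finset.sum_comm]
    refine Finset.sum_congr rfl fun j _ => ?_
    rw [Matrix.mul_apply, Finset.sum_mul]
    exact Finset.sum_congr rfl fun i _ => by rw [Matrix.transpose_apply]; ring
  simp only [metricTrace, inverseMetric_eq, h1, hPe, map_sum, map_smul, sum_apply,
    smul_apply, Finset.smul_sum, Finset.sum_smul, smul_smul]
  calc _ = ∑ i, ∑ j, ∑ k, ∑ l, ((gram (G' y))⁻¹ i j * Q k i * Q l j)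
        • T (coordVec k) (coordVec l) := by
        refine Finset.sum_congr rfl fun i _ => Finset.sum_congr rfl fun j _ => ?_
        rw [Finset.sum_comm]
        exact Finset.sum_congr rfl fun k _ => Finset.sum_congr rfl fun l _ => by congr 1; ring
    _ = ∑ i, ∑ k, ∑ j, ∑ l, ((gram (G' y))⁻¹ i j * Q k i * Q l j)
        • T (coordVec k) (coordVec l) :=
        Finset.sum_congr rfl fun i _ => Finset.sum_comm
    _ = ∑ k, ∑ i, ∑ j, ∑ l, ((gram (G' y))⁻¹ i j * Q k i * Q l j)
        • T (coordVec k) (coordVec l) := Finset.sum_comm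
    _ = ∑ k, ∑ i, ∑ l, ∑ j, ((gram (G' y))⁻¹ i j * Q k i * Q l j)
        • T (coordVec k) (coordVec l) :=
        Finset.sum_congr rfl fun k _ => Finset.sum_congr rfl fun i _ => Finset.sum_comm
    _ = _ := Finset.sum_congr rfl fun k _ => Finset.sum_comm

end InnerProducts

/-! ### The Levi-Civita connection in coordinates and local isometric immersions. -/

section LeviCivita

variable {m n : ℕ}

/-- `G` is a Riemannian metric on the open set `U`. -/
structure MetricOn (G : Coord m → Coord m →L[ℝ] Coord m →L[ℝ] ℝ) (U : Set (Coord m)) : Prop where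
  isOpen : IsOpen U
  smooth : ContDiffOn ℝ ∞ G U
  isInner : ∀ x ∈ U, IsInner (G x)

variable {G : Coord m → Coord m →L[ℝ] Coord m →L[ℝ] ℝ} {U : Set (Coord m)}
  {H : Coord n → Coord n →L[ℝ] Coord n →L[ℝ] ℝ} {O : Set (Coord n)} {φ : Coord m → Coord n}

theorem MetricOn.contDiffAt (hG : MetricOn G U) {x : Coord m} (hx : x ∈ U) : ContDiffAt ℝ ∞ G x :=
  hG.smooth.contDiffAt (hG.isOpen.mem_nhds hx)

theorem christoffel_eq_sharp (G : Coord m → Coord m →L[ℝ] Coord m →L[ℝ] ℝ) (x v w : Coord m) :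
    christoffel G x v w = sharp (G x) fun l => (1 / 2 : ℝ) * (fderiv ℝ G x v w (coordVec l)
      + fderiv ℝ G x w v (coordVec l) - fderiv ℝ G x (coordVec l) v w) := rfl

theorem gradient_eq_sharp (G : Coord m → Coord m →L[ℝ] Coord m →L[ℝ] ℝ) (f : Coord m → ℝ)
    (x : Coord m) : gradient G f x = sharp (G x) fun j => fderiv ℝ f x (coordVec j) := rfl

theorem tangentPart_eq_sharp (G : Coord m → Coord m →L[ℝ] Coord m →L[ℝ] ℝ)
    (H : Coord n → Coord n →L[ℝ] Coord n →L[ℝ] ℝ) (φ : Coord m → Coord n) (x : Coord m)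
    (W : Coord n) :
    tangentPart G H φ x W = sharp (G x) fun j => H (φ x) W (fderiv ℝ φ x (coordVec j)) := rfl

/-- Koszul's formula: pairing with `G` cancels the inverse matrix in the Christoffel symbols. -/
theorem MetricOn.apply_christoffel (hG : MetricOn G U) {x : Coord m} (hx : x ∈ U)
    (v w l : Coord m) : G x (christoffel G x v w) l
      = (1 / 2 : ℝ) * (fderiv ℝ G x v w l + fderiv ℝ G x w v l - fderiv ℝ G x l v w) := by
  rw [christoffel_eq_sharp]
  exact (hG.isInner x hx).apply_sharp_clm ((1 / 2 : ℝ) • (fderiv ℝ G x v w + fderiv ℝ G x w v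
    - ((fderiv ℝ G x).flip v).flip w)) l

/-- The Levi-Civita connection as a bilinear map. -/
def christoffelL (G : Coord m → Coord m →L[ℝ] Coord m →L[ℝ] ℝ) (x : Coord m) :
    Coord m →L[ℝ] Coord m →L[ℝ] Coord m :=
  LinearMap.toContinuousLinearMap (LinearMap.toContinuousLinearMap.toLinearMap ∘ₗ
    LinearMap.mk₂ ℝ (christoffel G x)
      (fun v v' w => by
        simp only [christoffel_eq_sharp, ← sharp_add]
        congr 1; funext l
        simp only [map_add, add_apply, Pi.add_apply]; ring)
      (fun c v w => by
        simp only [christoffel_eq_sharp, ← sharp_smul]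
        congr 1; funext l
        simp only [map_smul, smul_apply, Pi.smul_apply, smul_eq_mul]; ring)
      (fun v w w' => by
        simp only [christoffel_eq_sharp, ← sharp_add]
        congr 1; funext l
        simp only [map_add, add_apply, Pi.add_apply]; ring)
      (fun c v w => by
        simp only [christoffel_eq_sharp, ← sharp_smul]
        congr 1; funext l
        simp only [map_smul, smul_apply, Pi.smul_apply, smul_eq_mul]; ring))

theorem christoffelL_apply (G : Coord m → Coord m →L[ℝ] Coord m →L[ℝ] ℝ) (x v w : Coord m) :
    christoffelL G x v w = christoffel G x v w := rfl

theorem contDiffOn_det {p : ℕ} {E : Type*} [NormedAddCommGroup E] [NormedSpace ℝ E] {s : Set E}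
    {A : E → Matrix (Fin p) (Fin p) ℝ} (hA : ∀ i j, ContDiffOn ℝ ∞ (fun x => A x i j) s) :
    ContDiffOn ℝ ∞ (fun x => (A x).det) s := by
  simp only [Matrix.det_apply]
  refine ContDiffOn.sum fun σ _ => ?_
  refine ContDiffOn.const_smul _ ?_
  exact contDiffOn_prod fun i _ => hA _ _

/-- By Cramer's rule the entries are the adjugate divided by the determinant, polynomials in smooth
functions with a nonvanishing denominator. -/
theorem MetricOn.contDiffOn_inverseMetric (hG : MetricOn G U) (i j : Fin m) :
    ContDiffOn ℝ ∞ (fun x => inverseMetric G x i j) U := by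
  have hg (i j) : ContDiffOn ℝ ∞ (fun x => gram (G x) i j) U :=
    (hG.smooth.clm_apply contDiffOn_const).clm_apply contDiffOn_const
  have hdet := contDiffOn_det hg
  have hadj : ContDiffOn ℝ ∞ (fun x => (gram (G x)).adjugate i j) U := by
    simp only [Matrix.adjugate_apply]
    refine contDiffOn_det fun k l => ?_
    simp only [Matrix.updateRow_apply]
    split_ifs
    · exact contDiffOn_const
    · exact hg k l
  have : ∀ x ∈ U, inverseMetric G x i j = (gram (G x)).det⁻¹ * (gram (G x)).adjugate i j := by
    intro x _
    rw [inverseMetric_eq, Matrix.inv_def, Matrix.smul_apply, Ring.inverse_eq_inv', smul_eq_mul]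
  refine ContDiffOn.congr ?_ this
  exact (hdet.inv fun x hx => (hG.isInner x hx).isUnit_det.ne_zero).mul hadj

theorem MetricOn.contDiffOn_fderiv (hG : MetricOn G U) : ContDiffOn ℝ ∞ (fderiv ℝ G) U :=
  hG.smooth.fderiv_of_isOpen hG.isOpen (by simp)

theorem MetricOn.contDiffOn_christoffelL (hG : MetricOn G U) :
    ContDiffOn ℝ ∞ (christoffelL G) U := by
  rw [contDiffOn_clm_apply]
  intro v
  rw [contDiffOn_clm_apply]
  intro w
  simp only [christoffelL_apply, christoffel]
  refine ContDiffOn.sum fun k _ => ContDiffOn.fun_smul (ContDiffOn.sum fun l _ => ?_) contDiffOn_const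
  have hd (a b c : Coord m) : ContDiffOn ℝ ∞ (fun x => fderiv ℝ G x a b c) U :=
    ((hG.contDiffOn_fderiv.clm_apply contDiffOn_const).clm_apply
      contDiffOn_const).clm_apply contDiffOn_const
  exact (hG.contDiffOn_inverseMetric k l).mul
    (contDiffOn_const.mul (((hd _ _ _).add (hd _ _ _)).sub (hd _ _ _)))

/-- `φ` is a smooth isometric immersion between open subsets of coordinate spaces. -/
structure IsometricOn (G : Coord m → Coord m →L[ℝ] Coord m →L[ℝ] ℝ) (U : Set (Coord m))
    (H : Coord n → Coord n →L[ℝ] Coord n →L[ℝ] ℝ) (O : Set (Coord n)) (φ : Coord m → Coord n) :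
    Prop where
  source : MetricOn G U
  target : MetricOn H O
  mapsTo : Set.MapsTo φ U O
  smooth : ContDiffOn ℝ ∞ φ U
  isometric : ∀ x ∈ U, ∀ v w, H (φ x) (fderiv ℝ φ x v) (fderiv ℝ φ x w) = G x v w

theorem hasFDerivAt_fderiv_apply {x : Coord m} (hφ : ContDiffAt ℝ ∞ φ x) (w : Coord m) :
    HasFDerivAt (fun z => fderiv ℝ φ z w) ((fderiv ℝ (fderiv ℝ φ) x).flip w) x := by
  have hd : DifferentiableAt ℝ (fderiv ℝ φ) x :=
    (hφ.fderiv_right (m := ∞) (by simp)).differentiableAt (by simp)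
  have := hd.hasFDerivAt.clm_apply (hasFDerivAt_const w x)
  rwa [ContinuousLinearMap.comp_zero, zero_add] at this

theorem fderiv_fderiv_comm {x : Coord m} (hφ : ContDiffAt ℝ ∞ φ x) (v w : Coord m) :
    fderiv ℝ (fderiv ℝ φ) x v w = fderiv ℝ (fderiv ℝ φ) x w v := by
  have h2 : (2 : WithTop ℕ∞) ≤ ∞ := WithTop.coe_le_coe.2 (le_top : (2 : ℕ∞) ≤ ⊤)
  exact (hφ.isSymmSndFDerivAt (by simpa using h2)).eq _ _

theorem covAlong_fderiv {x : Coord m} (hφ : ContDiffAt ℝ ∞ φ x) (v w : Coord m) :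
    covAlong H φ (fun z => fderiv ℝ φ z w) x v
      = fderiv ℝ (fderiv ℝ φ) x v w + christoffelL H (φ x) (fderiv ℝ φ x v) (fderiv ℝ φ x w) := by
  rw [covAlong, (hasFDerivAt_fderiv_apply hφ w).fderiv]; rfl

namespace IsometricOn

variable (h : IsometricOn G U H O φ)

include h

theorem contDiffAt {x : Coord m} (hx : x ∈ U) : ContDiffAt ℝ ∞ φ x :=
  h.smooth.contDiffAt (h.source.isOpen.mem_nhds hx)

end IsometricOn

end LeviCivita

/-! ### Tension field of an isometric immersion: normality and coordinate invariance. -/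

section IsometricImmersions

open Filter Topology

variable {m n : ℕ} {G G' : Coord m → Coord m →L[ℝ] Coord m →L[ℝ] ℝ} {U U' : Set (Coord m)}
  {H H' : Coord n → Coord n →L[ℝ] Coord n →L[ℝ] ℝ} {O O' : Set (Coord n)}
  {φ φ' : Coord m → Coord n}

theorem tangentPart_add (G : Coord m → Coord m →L[ℝ] Coord m →L[ℝ] ℝ)
    (H : Coord n → Coord n →L[ℝ] Coord n →L[ℝ] ℝ) (φ : Coord m → Coord n) (x : Coord m)
    (W W' : Coord n) :
    tangentPart G H φ x (W + W') = tangentPart G H φ x W + tangentPart G H φ x W' := by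
  simp only [tangentPart_eq_sharp, ← sharp_add]
  congr 1; funext l
  simp only [map_add, add_apply, Pi.add_apply]

theorem tangentPart_smul (G : Coord m → Coord m →L[ℝ] Coord m →L[ℝ] ℝ)
    (H : Coord n → Coord n →L[ℝ] Coord n →L[ℝ] ℝ) (φ : Coord m → Coord n) (x : Coord m)
    (c : ℝ) (W : Coord n) : tangentPart G H φ x (c • W) = c • tangentPart G H φ x W := by
  simp only [tangentPart_eq_sharp, ← sharp_smul]
  congr 1; funext l
  simp only [map_smul, smul_apply, Pi.smul_apply]

/-- `tangentPart` as a linear map. -/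
def tangentPartL (G : Coord m → Coord m →L[ℝ] Coord m →L[ℝ] ℝ)
    (H : Coord n → Coord n →L[ℝ] Coord n →L[ℝ] ℝ) (φ : Coord m → Coord n) (x : Coord m) :
    Coord n →ₗ[ℝ] Coord m where
  toFun := tangentPart G H φ x
  map_add' := tangentPart_add G H φ x
  map_smul' := tangentPart_smul G H φ x

theorem covAlong_smul (H : Coord n → Coord n →L[ℝ] Coord n →L[ℝ] ℝ) (φ : Coord m → Coord n)
    {V : Coord m → Coord n} {x : Coord m} (hV : DifferentiableAt ℝ V x) (c : ℝ) (v : Coord m) :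
    covAlong H φ (fun z => c • V z) x v = c • covAlong H φ V x v := by
  rw [covAlong, covAlong, fderiv_fun_const_smul hV, ← christoffelL_apply, ← christoffelL_apply,
    map_smul, smul_add, smul_apply]

theorem covAlong_congr (H : Coord n → Coord n →L[ℝ] Coord n →L[ℝ] ℝ) (φ : Coord m → Coord n)
    {V W : Coord m → Coord n} {x : Coord m} (h : V =ᶠ[𝓝 x] W) (v : Coord m) :
    covAlong H φ V x v = covAlong H φ W x v := by
  rw [covAlong, covAlong, h.fderiv_eq, h.self_of_nhds]

/-- The Hessian `∇dφ` as a bilinear map. -/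
def hess (G : Coord m → Coord m →L[ℝ] Coord m →L[ℝ] ℝ)
    (H : Coord n → Coord n →L[ℝ] Coord n →L[ℝ] ℝ) (φ : Coord m → Coord n) (x : Coord m) :
    Coord m →L[ℝ] Coord m →L[ℝ] Coord n :=
  fderiv ℝ (fderiv ℝ φ) x
    + (christoffelL H (φ x)).bilinearComp (fderiv ℝ φ x) (fderiv ℝ φ x)
    - (ContinuousLinearMap.compL ℝ (Coord m) (Coord m) (Coord n) (fderiv ℝ φ x)).comp
        (christoffelL G x)

theorem hess_apply (x v w : Coord m) : hess G H φ x v w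
    = fderiv ℝ (fderiv ℝ φ) x v w + christoffelL H (φ x) (fderiv ℝ φ x v) (fderiv ℝ φ x w)
      - fderiv ℝ φ x (christoffelL G x v w) := rfl

theorem hess_eq {x : Coord m} (hφ : ContDiffAt ℝ ∞ φ x) (v w : Coord m) :
    covAlong H φ (fun z => fderiv ℝ φ z w) x v - fderiv ℝ φ x (christoffel G x v w)
      = hess G H φ x v w := by
  rw [covAlong_fderiv hφ, hess_apply]; rfl

theorem tension_eq_metricTrace_hess {x : Coord m} (hφ : ContDiffAt ℝ ∞ φ x) :
    tension G H φ x = metricTrace G x fun v w => hess G H φ x v w := by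
  simp only [tension, hess_eq hφ]

theorem contDiffOn_tension (hG : MetricOn G U) (hH : MetricOn H O) (hm : Set.MapsTo φ U O)
    (hφ : ContDiffOn ℝ ∞ φ U) : ContDiffOn ℝ ∞ (tension G H φ) U := by
  have hD : ContDiffOn ℝ ∞ (fderiv ℝ φ) U := hφ.fderiv_of_isOpen hG.isOpen (by simp)
  have hD2 : ContDiffOn ℝ ∞ (fderiv ℝ (fderiv ℝ φ)) U := hD.fderiv_of_isOpen hG.isOpen (by simp)
  have hΓ : ContDiffOn ℝ ∞ (fun x => christoffelL H (φ x)) U :=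
    hH.contDiffOn_christoffelL.comp hφ hm
  have hDv (v : Coord m) : ContDiffOn ℝ ∞ (fun x => fderiv ℝ φ x v) U :=
    hD.clm_apply contDiffOn_const
  have h1 : ∀ x ∈ U, tension G H φ x = ∑ i, ∑ j, inverseMetric G x i j •
      (fderiv ℝ (fderiv ℝ φ) x (coordVec i) (coordVec j)
        + christoffelL H (φ x) (fderiv ℝ φ x (coordVec i)) (fderiv ℝ φ x (coordVec j))
        - fderiv ℝ φ x (christoffelL G x (coordVec i) (coordVec j))) := fun x hx =>
    tension_eq_metricTrace_hess (hφ.contDiffAt (hG.isOpen.mem_nhds hx))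
  refine ContDiffOn.congr (ContDiffOn.sum fun i _ => ContDiffOn.sum fun j _ => ?_) h1
  refine (hG.contDiffOn_inverseMetric i j).fun_smul (ContDiffOn.sub (ContDiffOn.add ?_ ?_) ?_)
  · exact (hD2.clm_apply contDiffOn_const).clm_apply contDiffOn_const
  · exact (hΓ.clm_apply (hDv _)).clm_apply (hDv _)
  · exact hD.clm_apply ((hG.contDiffOn_christoffelL.clm_apply contDiffOn_const).clm_apply
      contDiffOn_const)

/-- The second derivative of a composition. -/
theorem fderiv_fderiv_comp {p : ℕ} {θ : Coord n → Coord p} {x : Coord m}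
    (hθ : ContDiffAt ℝ ∞ θ (φ x)) (hφ : ContDiffAt ℝ ∞ φ x) (v w : Coord m) :
    fderiv ℝ (fderiv ℝ (fun z => θ (φ z))) x v w
      = fderiv ℝ (fderiv ℝ θ) (φ x) (fderiv ℝ φ x v) (fderiv ℝ φ x w)
        + fderiv ℝ θ (φ x) (fderiv ℝ (fderiv ℝ φ) x v w) := by
  have hcomp : ContDiffAt ℝ ∞ (fun z => θ (φ z)) x := hθ.comp x hφ
  have hev : (fun z => fderiv ℝ (fun z => θ (φ z)) z w)
      =ᶠ[𝓝 x] fun z => fderiv ℝ θ (φ z) (fderiv ℝ φ z w) := by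
    have h1 : ∀ᶠ y in 𝓝 (φ x), ContDiffAt ℝ 1 θ y :=
      (hθ.of_le (by simp)).eventually (by simp)
    have h2 : ∀ᶠ y in 𝓝 x, ContDiffAt ℝ 1 φ y := (hφ.of_le (by simp)).eventually (by simp)
    filter_upwards [hφ.continuousAt.eventually h1, h2] with y hy1 hy2
    have := (hy1.differentiableAt (by simp)).hasFDerivAt.comp y
      (hy2.differentiableAt (by simp)).hasFDerivAt
    rw [show (fun z => θ (φ z)) = θ ∘ φ from rfl, this.fderiv]
    rfl
  have hl := (hasFDerivAt_fderiv_apply hcomp w).fderiv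
  have hdθ : HasFDerivAt (fderiv ℝ θ) (fderiv ℝ (fderiv ℝ θ) (φ x)) (φ x) :=
    ((hθ.fderiv_right (m := ∞) (by simp)).differentiableAt (by simp)).hasFDerivAt
  have hdφ : HasFDerivAt φ (fderiv ℝ φ x) x := (hφ.differentiableAt (by simp)).hasFDerivAt
  have hr := (hdθ.comp x hdφ).clm_apply (hasFDerivAt_fderiv_apply hφ w)
  have e : fderiv ℝ (fun z => fderiv ℝ (fun z => θ (φ z)) z w) x v
      = fderiv ℝ (fun z => fderiv ℝ θ (φ z) (fderiv ℝ φ z w)) x v := by rw [hev.fderiv_eq]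
  rw [hl] at e
  have e2 : fderiv ℝ (fun z => fderiv ℝ θ (φ z) (fderiv ℝ φ z w)) x = _ := hr.fderiv
  rw [e2] at e
  rw [show fderiv ℝ (fderiv ℝ (fun z => θ (φ z))) x v w
    = (fderiv ℝ (fderiv ℝ (fun z => θ (φ z))) x).flip w v from rfl, e, add_comm]
  rfl

namespace IsometricOn

/-- This is the derivative of the identity `φ^*H = G`. -/
theorem fderiv_metric (h : IsometricOn G U H O φ) {x : Coord m} (hx : x ∈ U) (v w l : Coord m) :
    fderiv ℝ G x v w l = fderiv ℝ H (φ x) (fderiv ℝ φ x v) (fderiv ℝ φ x w) (fderiv ℝ φ x l)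
      + H (φ x) (fderiv ℝ (fderiv ℝ φ) x v w) (fderiv ℝ φ x l)
      + H (φ x) (fderiv ℝ φ x w) (fderiv ℝ (fderiv ℝ φ) x v l) := by
  have hφ := h.contDiffAt hx
  have hdG : HasFDerivAt G (fderiv ℝ G x) x :=
    ((h.source.contDiffAt hx).differentiableAt (by simp)).hasFDerivAt
  have hdH : HasFDerivAt H (fderiv ℝ H (φ x)) (φ x) :=
    ((h.target.contDiffAt (h.mapsTo hx)).differentiableAt (by simp)).hasFDerivAt
  have hdφ : HasFDerivAt φ (fderiv ℝ φ x) x := (hφ.differentiableAt (by simp)).hasFDerivAt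
  have hL := (hdG.clm_apply (hasFDerivAt_const w x)).clm_apply (hasFDerivAt_const l x)
  have hR := ((hdH.comp x hdφ).clm_apply (hasFDerivAt_fderiv_apply hφ w)).clm_apply
    (hasFDerivAt_fderiv_apply hφ l)
  have hev : (fun z => G z w l) =ᶠ[𝓝 x] fun z => H (φ z) (fderiv ℝ φ z w) (fderiv ℝ φ z l) := by
    filter_upwards [h.source.isOpen.mem_nhds hx] with y hy
    rw [h.isometric y hy]
  have e := hL.unique (hR.congr_of_eventuallyEq hev)
  have := congrArg (fun L : Coord m →L[ℝ] ℝ => L v) e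
  simp only [ContinuousLinearMap.comp_zero, zero_add, ContinuousLinearMap.flip_apply, add_apply,
    ContinuousLinearMap.comp_apply, Function.comp_apply] at this
  rw [this]
  ring

/-- The tangential part of `∇^φ dφ` is the Levi-Civita connection of the source. In Koszul's formula
the second derivatives of `φ` cancel by symmetry, except for `D²φ(v, w)`. -/
theorem apply_christoffel (h : IsometricOn G U H O φ) {x : Coord m} (hx : x ∈ U)
    (v w l : Coord m) : G x (christoffel G x v w) l
      = H (φ x) (covAlong H φ (fun z => fderiv ℝ φ z w) x v) (fderiv ℝ φ x l) := by
  have hφ := h.contDiffAt hx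
  have hI := h.target.isInner _ (h.mapsTo hx)
  rw [h.source.apply_christoffel hx, covAlong_fderiv hφ, map_add, add_apply, christoffelL_apply,
    h.target.apply_christoffel (h.mapsTo hx), h.fderiv_metric hx, h.fderiv_metric hx,
    h.fderiv_metric hx, fderiv_fderiv_comm hφ w v, fderiv_fderiv_comm hφ l v,
    fderiv_fderiv_comm hφ l w, hI.symm (fderiv ℝ φ x v) (fderiv ℝ (fderiv ℝ φ) x w l),
    hI.symm (fderiv ℝ φ x w) (fderiv ℝ (fderiv ℝ φ) x v l)]
  ring

theorem tangentPart_covAlong (h : IsometricOn G U H O φ) {x : Coord m} (hx : x ∈ U)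
    (v w : Coord m) :
    tangentPart G H φ x (covAlong H φ (fun z => fderiv ℝ φ z w) x v) = christoffel G x v w :=
  (h.source.isInner x hx).sharp_eq fun j => h.apply_christoffel hx v w (coordVec j)

theorem tangentPart_fderiv (h : IsometricOn G U H O φ) {x : Coord m} (hx : x ∈ U) (v : Coord m) :
    tangentPart G H φ x (fderiv ℝ φ x v) = v :=
  (h.source.isInner x hx).sharp_eq fun j => (h.isometric x hx v (coordVec j)).symm

theorem injective_fderiv (h : IsometricOn G U H O φ) {x : Coord m} (hx : x ∈ U) :
    Function.Injective (fderiv ℝ φ x) :=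
  Function.LeftInverse.injective (h.tangentPart_fderiv hx)

theorem tension_eq (h : IsometricOn G U H O φ) {x : Coord m} (hx : x ∈ U) :
    tension G H φ x = metricTrace G x fun v w => secondFundForm G H φ x v w := by
  simp only [tension, secondFundForm, h.tangentPart_covAlong hx]

theorem meanCurvature_eq (h : IsometricOn G U H O φ) {x : Coord m} (hx : x ∈ U) :
    meanCurvature G H φ x = (1 / m : ℝ) • tension G H φ x := by
  rw [h.tension_eq hx, meanCurvature]

/-- The Hessian `∇dφ` of an isometric immersion is normal, and so is its trace. -/
theorem tangentPart_tension (h : IsometricOn G U H O φ) {x : Coord m} (hx : x ∈ U) :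
    tangentPart G H φ x (tension G H φ x) = 0 := by
  rw [show tangentPart G H φ x (tension G H φ x) = tangentPartL G H φ x (tension G H φ x) from rfl,
    tension, map_metricTrace]
  have (v w : Coord m) : tangentPartL G H φ x (covAlong H φ (fun z => fderiv ℝ φ z w) x v
      - fderiv ℝ φ x (christoffel G x v w)) = 0 := by
    rw [map_sub]
    change tangentPart G H φ x _ - tangentPart G H φ x _ = 0
    rw [h.tangentPart_covAlong hx, h.tangentPart_fderiv hx, sub_self]
  simp only [this, metricTrace, smul_zero, Finset.sum_const_zero]

/-- At a point where `φ` is pseudo-umbilical, biharmonic and `f`-biharmonic, `df = 0` or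
`τ(φ) = 0`. -/
theorem fderiv_eq_zero_or_tension_eq_zero (h : IsometricOn G U H O φ) {x : Coord m} (hx : x ∈ U)
    (humb : ∀ v : Coord m, shapeOperator G H φ (meanCurvature G H φ) x v
      = H (φ x) (meanCurvature G H φ x) (meanCurvature G H φ x) • v)
    (hbi : bitension G H φ x = 0) {f : Coord m → ℝ} (hf : fBitension G H φ f x = 0) :
    fderiv ℝ f x = 0 ∨ tension G H φ x = 0 := by
  by_cases hτ : tension G H φ x = 0
  · exact Or.inr hτ
  left
  -- In dimension zero the trace is an empty sum, so `τ ≠ 0` excludes that case; otherwise `1/m`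
  -- would be 0 and `η` would vanish with it.
  have hm : (m : ℝ) ≠ 0 := by
    intro h0
    have : m = 0 := by exact_mod_cast h0
    subst this
    exact hτ (by simp [tension, metricTrace])
  have hη : meanCurvature G H φ x ≠ 0 := by
    rw [h.meanCurvature_eq hx]
    exact smul_ne_zero (one_div_ne_zero hm) hτ
  have hev : meanCurvature G H φ =ᶠ[𝓝 x] fun z => (1 / m : ℝ) • tension G H φ z := by
    filter_upwards [h.source.isOpen.mem_nhds hx] with y hy
    exact h.meanCurvature_eq hy
  have hdτ : DifferentiableAt ℝ (tension G H φ) x :=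
    ((contDiffOn_tension h.source h.target h.mapsTo h.smooth).contDiffAt
      (h.source.isOpen.mem_nhds hx)).differentiableAt (by simp)
  -- Pseudo-umbilicity is tested on `grad f`, the direction in which the `f`-biharmonic equation
  -- differentiates `τ`.
  have hu := humb (gradient G f x)
  rw [shapeOperator, covAlong_congr H φ hev, covAlong_smul H φ hdτ, tangentPart_smul] at hu
  rw [fBitension, hbi, smul_zero, zero_add] at hf
  -- The term `(Δf) τ` is normal, so the tangential part keeps only `2 ∇_{grad f} τ`.
  have ht := congrArg (tangentPart G H φ x) hf
  have h0 : tangentPart G H φ x 0 = 0 := (tangentPartL G H φ x).map_zero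
  rw [tangentPart_add, tangentPart_smul, tangentPart_smul, h.tangentPart_tension hx, smul_zero,
    zero_add, h0, smul_eq_zero] at ht
  rw [ht.resolve_left two_ne_zero, smul_zero, neg_zero, eq_comm, smul_eq_zero] at hu
  have hg : gradient G f x = 0 :=
    hu.resolve_left ((h.target.isInner _ (h.mapsTo hx)).pos _ hη).ne'
  ext l
  rw [← (h.source.isInner x hx).apply_sharp_clm (fderiv ℝ f x) l, ← gradient_eq_sharp, hg]
  simp

/-- The transformation law of the Levi-Civita connection. -/
theorem fderiv_christoffel {ψ : Coord m → Coord m} (h : IsometricOn G' U' G U ψ) {x : Coord m}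
    (hx : x ∈ U') (v w : Coord m) : fderiv ℝ ψ x (christoffelL G' x v w)
      = fderiv ℝ (fderiv ℝ ψ) x v w + christoffelL G (ψ x) (fderiv ℝ ψ x v) (fderiv ℝ ψ x w) := by
  rw [← covAlong_fderiv (h.contDiffAt hx)]
  refine (h.target.isInner _ (h.mapsTo hx)).ext_right fun l => ?_
  -- Source and target have the same dimension, so the injective differential is surjective and
  -- every test vector lies in its image.
  obtain ⟨l, rfl⟩ := (LinearMap.injective_iff_surjective (f := (fderiv ℝ ψ x).toLinearMap)).1
    (h.injective_fderiv hx) l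
  exact (h.isometric x hx _ l).trans (h.apply_christoffel hx v w l)

/-- The tension field does not depend on the choice of coordinates. -/
theorem fderiv_tension {ψ : Coord m → Coord m} {θ : Coord n → Coord n}
    (hψ : IsometricOn G' U' G U ψ) (hθ : IsometricOn H' O' H O θ) {x : Coord m} (hx : x ∈ U')
    (hφ' : ContDiffAt ℝ ∞ φ' x) (hφ : ContDiffAt ℝ ∞ φ (ψ x)) (hxO : φ' x ∈ O')
    (heq : (fun z => θ (φ' z)) =ᶠ[𝓝 x] fun z => φ (ψ z)) :
    fderiv ℝ θ (φ' x) (tension G' H' φ' x) = tension G H φ (ψ x) := by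
  have hψx := hψ.contDiffAt hx
  have hθx := hθ.contDiffAt hxO
  have h1 (v : Coord m) : fderiv ℝ θ (φ' x) (fderiv ℝ φ' x v)
      = fderiv ℝ φ (ψ x) (fderiv ℝ ψ x v) := by
    have e1 := ((hθx.differentiableAt (by simp)).hasFDerivAt.comp x
      (hφ'.differentiableAt (by simp)).hasFDerivAt)
    have e2 := ((hφ.differentiableAt (by simp)).hasFDerivAt.comp x
      (hψx.differentiableAt (by simp)).hasFDerivAt)
    have := e1.unique (e2.congr_of_eventuallyEq heq)
    exact congrArg (fun L : Coord m →L[ℝ] Coord n => L v) this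
  have h2 (v w : Coord m) := fderiv_fderiv_comp hθx hφ' v w
  have h3 (v w : Coord m) := fderiv_fderiv_comp hφ hψx v w
  have h4 : fderiv ℝ (fderiv ℝ fun z => θ (φ' z)) x = fderiv ℝ (fderiv ℝ fun z => φ (ψ z)) x :=
    (heq.fderiv (𝕜 := ℝ)).fderiv_eq
  have hval : θ (φ' x) = φ (ψ x) := heq.self_of_nhds
  -- The Hessian is tensorial: the second derivatives from the chain rule match the inhomogeneous
  -- terms in the transformation laws of the two connections.
  have key (v w : Coord m) : fderiv ℝ θ (φ' x) (hess G' H' φ' x v w)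
      = hess G H φ (ψ x) (fderiv ℝ ψ x v) (fderiv ℝ ψ x w) := by
    have e := (h2 v w).symm.trans ((congrArg (fun L => L v w) h4).trans (h3 v w))
    rw [hess_apply, hess_apply, map_sub, map_add, hθ.fderiv_christoffel hxO, h1, h1, h1,
      hψ.fderiv_christoffel hx, map_add, ← hval]
    rw [← sub_eq_zero] at e ⊢
    rw [← e]
    abel
  rw [tension_eq_metricTrace_hess hφ', tension_eq_metricTrace_hess hφ,
    show fderiv ℝ θ (φ' x) (metricTrace G' x fun v w => hess G' H' φ' x v w)
      = (fderiv ℝ θ (φ' x)).toLinearMap (metricTrace G' x fun v w => hess G' H' φ' x v w) from rfl,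
    map_metricTrace]
  refine Eq.trans ?_ (metricTrace_comp (hψ.source.isInner x hx) (fderiv ℝ ψ x)
    (fun v w => (hψ.isometric x hx v w).symm) (hess G H φ (ψ x)))
  congr 1
  funext v w
  exact key v w

end IsometricOn

end IsometricImmersions

/-! ### Bookkeeping for estimates by a constant multiple of a fixed function. -/

section LinearBounds

variable {E W W' : Type*} [NormedAddCommGroup W] [NormedAddCommGroup W'] {K : Set E} {N : E → ℝ}

/-- `‖f‖` is at most a constant times `N` on `K`. -/
def BoundedBy (K : Set E) (N : E → ℝ) (f : E → W) : Prop :=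
  ∃ C, ∀ x ∈ K, ‖f x‖ ≤ C * N x

theorem BoundedBy.add {f g : E → W} (hf : BoundedBy K N f) (hg : BoundedBy K N g) :
    BoundedBy K N fun x => f x + g x := by
  obtain ⟨C, hC⟩ := hf
  obtain ⟨D, hD⟩ := hg
  refine ⟨C + D, fun x hx => (norm_add_le _ _).trans ?_⟩
  rw [add_mul]
  exact add_le_add (hC x hx) (hD x hx)

theorem BoundedBy.sub {f g : E → W} (hf : BoundedBy K N f) (hg : BoundedBy K N g) :
    BoundedBy K N fun x => f x - g x := by
  obtain ⟨C, hC⟩ := hf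
  obtain ⟨D, hD⟩ := hg
  refine ⟨C + D, fun x hx => (norm_sub_le _ _).trans ?_⟩
  rw [add_mul]
  exact add_le_add (hC x hx) (hD x hx)

theorem BoundedBy.sum {ι : Type*} (s : Finset ι) {f : ι → E → W}
    (hf : ∀ i, BoundedBy K N (f i)) : BoundedBy K N fun x => ∑ i ∈ s, f i x := by
  choose C hC using hf
  refine ⟨∑ i ∈ s, C i, fun x hx => (norm_sum_le _ _).trans ?_⟩
  rw [Finset.sum_mul]
  exact Finset.sum_le_sum fun i _ => hC i x hx

variable [TopologicalSpace E] [NormedSpace ℝ W] [NormedSpace ℝ W']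

theorem BoundedBy.clm (hK : IsCompact K) {L : E → W →L[ℝ] W'} (hL : ContinuousOn L K) {f : E → W}
    (hf : BoundedBy K N f) : BoundedBy K N fun x => L x (f x) := by
  obtain ⟨C, hC⟩ := hf
  obtain ⟨D, hD⟩ := hK.exists_bound_of_continuousOn hL
  refine ⟨D * C, fun x hx => ((L x).le_opNorm _).trans ?_⟩
  rw [mul_assoc]
  exact mul_le_mul (hD x hx) (hC x hx) (norm_nonneg _) ((norm_nonneg _).trans (hD x hx))

theorem BoundedBy.apply (hK : IsCompact K) {f : E → W →L[ℝ] W'} (hf : BoundedBy K N f) {c : E → W}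
    (hc : ContinuousOn c K) : BoundedBy K N fun x => f x (c x) := by
  obtain ⟨C, hC⟩ := hf
  obtain ⟨D, hD⟩ := hK.exists_bound_of_continuousOn hc
  refine ⟨C * D, fun x hx => ((f x).le_opNorm _).trans ?_⟩
  rw [mul_right_comm]
  exact mul_le_mul (hC x hx) (hD x hx) (norm_nonneg _) ((norm_nonneg _).trans (hC x hx))

theorem BoundedBy.smul (hK : IsCompact K) {c : E → ℝ} (hc : ContinuousOn c K) {f : E → W}
    (hf : BoundedBy K N f) : BoundedBy K N fun x => c x • f x := by
  obtain ⟨C, hC⟩ := hf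
  obtain ⟨D, hD⟩ := hK.exists_bound_of_continuousOn hc
  refine ⟨D * C, fun x hx => ?_⟩
  rw [norm_smul, mul_assoc]
  exact mul_le_mul (hD x hx) (hC x hx) (norm_nonneg _) ((norm_nonneg _).trans (hD x hx))

end LinearBounds

/-! ### The biharmonic equation as an elliptic system for the tension field. -/

section BiharmonicUniqueContinuation

open Filter Topology

variable {m n : ℕ} {G : Coord m → Coord m →L[ℝ] Coord m →L[ℝ] ℝ} {U : Set (Coord m)}
  {H : Coord n → Coord n →L[ℝ] Coord n →L[ℝ] ℝ} {O : Set (Coord n)} {φ V : Coord m → Coord n}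

theorem MetricOn.hasFDerivAt_christoffelL (hG : MetricOn G U) {x : Coord m} (hx : x ∈ U) :
    HasFDerivAt (christoffelL G) (fderiv ℝ (christoffelL G) x) x :=
  ((hG.contDiffOn_christoffelL.contDiffAt (hG.isOpen.mem_nhds hx)).differentiableAt
    (by simp)).hasFDerivAt

theorem MetricOn.curvature_eq (hH : MetricOn H O) {y : Coord n} (hy : y ∈ O) (u v w : Coord n) :
    curvature H y u v w
      = (fderiv ℝ (christoffelL H) y u v w + christoffelL H y u (christoffelL H y v w))
        - (fderiv ℝ (christoffelL H) y v u w + christoffelL H y v (christoffelL H y u w)) := by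
  have hd (a b c : Coord n) :
      fderiv ℝ (fun z => christoffel H z a b) y c = fderiv ℝ (christoffelL H) y c a b := by
    have := ((hH.hasFDerivAt_christoffelL hy).clm_apply (hasFDerivAt_const a y)).clm_apply
      (hasFDerivAt_const b y)
    simp only [christoffelL_apply] at this
    rw [this.fderiv]
    simp
  rw [curvature, hd, hd]; rfl

/-- The expansion isolates the pure second derivative of `V`; every other term is linear in `V` and
its first derivative. -/
theorem covAlong_covAlong (hH : MetricOn H O) {x : Coord m} (hx : φ x ∈ O)
    (hφ : ContDiffAt ℝ ∞ φ x) (hV : ContDiffAt ℝ ∞ V x) (v w : Coord m) :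
    covAlong H φ (fun z => covAlong H φ V z w) x v
      = fderiv ℝ (fun z => fderiv ℝ V z w) x v
        + (christoffelL H (φ x) (fderiv ℝ φ x w) (fderiv ℝ V x v)
          + christoffelL H (φ x) (fderiv ℝ (fderiv ℝ φ) x v w) (V x)
          + fderiv ℝ (christoffelL H) (φ x) (fderiv ℝ φ x v) (fderiv ℝ φ x w) (V x)
          + christoffelL H (φ x) (fderiv ℝ φ x v) (fderiv ℝ V x w)
          + christoffelL H (φ x) (fderiv ℝ φ x v)
            (christoffelL H (φ x) (fderiv ℝ φ x w) (V x))) := by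
  have hdV : HasFDerivAt V (fderiv ℝ V x) x := (hV.differentiableAt (by simp)).hasFDerivAt
  have hdφ : HasFDerivAt φ (fderiv ℝ φ x) x := (hφ.differentiableAt (by simp)).hasFDerivAt
  have h1 := (((hH.hasFDerivAt_christoffelL hx).comp x hdφ).clm_apply
    (hasFDerivAt_fderiv_apply hφ w)).clm_apply hdV
  have h2 := (hasFDerivAt_fderiv_apply hV w).add h1
  have h3 : fderiv ℝ (fun z => covAlong H φ V z w) x = _ := h2.fderiv
  rw [covAlong, h3, (hasFDerivAt_fderiv_apply hV w).fderiv, ← christoffelL_apply]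
  simp only [covAlong, ← christoffelL_apply, map_add, ContinuousLinearMap.flip_apply, add_apply,
    ContinuousLinearMap.comp_apply, Function.comp_apply]
  abel

namespace IsometricOn

/-- The principal part of the biharmonic equation is controlled by the lower order terms. -/
theorem exists_bound_of_biharmonic (h : IsometricOn G U H O φ)
    (hbi : ∀ x ∈ U, bitension G H φ x = 0) {K : Set (Coord m)} (hK : IsCompact K) (hKU : K ⊆ U) :
    ∃ C, ∀ x ∈ K, ‖∑ i, ∑ j, inverseMetric G x i j •
        fderiv ℝ (fun z => fderiv ℝ (tension G H φ) z (coordVec j)) x (coordVec i)‖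
      ≤ C * (‖tension G H φ x‖ + ‖fderiv ℝ (tension G H φ) x‖) := by
  set V := tension G H φ with hV
  set N : Coord m → ℝ := fun x => ‖V x‖ + ‖fderiv ℝ V x‖ with hN
  have hVs : ContDiffOn ℝ ∞ V U := contDiffOn_tension h.source h.target h.mapsTo h.smooth
  have hUo := h.source.isOpen
  have cD : ContDiffOn ℝ ∞ (fderiv ℝ φ) U := h.smooth.fderiv_of_isOpen hUo (by simp)
  have cD2 : ContDiffOn ℝ ∞ (fderiv ℝ (fderiv ℝ φ)) U := cD.fderiv_of_isOpen hUo (by simp)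
  have cΓ : ContDiffOn ℝ ∞ (fun x => christoffelL H (φ x)) U :=
    h.target.contDiffOn_christoffelL.comp h.smooth h.mapsTo
  have cDΓ : ContDiffOn ℝ ∞ (fun x => fderiv ℝ (christoffelL H) (φ x)) U :=
    (h.target.contDiffOn_christoffelL.fderiv_of_isOpen h.target.isOpen (m := ∞) (by simp)).comp
      h.smooth h.mapsTo
  have kD (v : Coord m) : ContinuousOn (fun x => fderiv ℝ φ x v) K :=
    (cD.continuousOn.mono hKU).clm_apply continuousOn_const
  have kD2 (v w : Coord m) : ContinuousOn (fun x => fderiv ℝ (fderiv ℝ φ) x v w) K :=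
    ((cD2.continuousOn.mono hKU).clm_apply continuousOn_const).clm_apply continuousOn_const
  have kΓ : ContinuousOn (fun x => christoffelL H (φ x)) K := cΓ.continuousOn.mono hKU
  have kDΓ : ContinuousOn (fun x => fderiv ℝ (christoffelL H) (φ x)) K :=
    cDΓ.continuousOn.mono hKU
  have kΓM (v w : Coord m) : ContinuousOn (fun x => christoffelL G x v w) K :=
    ((h.source.contDiffOn_christoffelL.continuousOn.mono hKU).clm_apply
      continuousOn_const).clm_apply continuousOn_const
  have bV : BoundedBy K N V := ⟨1, fun x _ => by simp [hN]⟩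
  have bDV : BoundedBy K N (fderiv ℝ V) := ⟨1, fun x _ => by simp [hN]⟩
  have bDVv (v : Coord m) : BoundedBy K N fun x => fderiv ℝ V x v :=
    bDV.apply hK continuousOn_const
  have bΓV (w : Coord m) : BoundedBy K N fun x => christoffelL H (φ x) (fderiv ℝ φ x w) (V x) :=
    bV.clm hK (kΓ.clm_apply (kD w))
  -- The lower order terms of the equation: `E` from the iterated covariant derivative, `F` from the
  -- correction `∇_{∇v w}`, and `R` from the curvature. Each is linear in `V` and its first
  -- derivative, with coefficients continuous on `K`.
  set E : Coord m → Coord m → Coord m → Coord n := fun v w x =>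
    (christoffelL H (φ x) (fderiv ℝ φ x w) (fderiv ℝ V x v)
      + christoffelL H (φ x) (fderiv ℝ (fderiv ℝ φ) x v w) (V x)
      + fderiv ℝ (christoffelL H) (φ x) (fderiv ℝ φ x v) (fderiv ℝ φ x w) (V x)
      + christoffelL H (φ x) (fderiv ℝ φ x v) (fderiv ℝ V x w)
      + christoffelL H (φ x) (fderiv ℝ φ x v)
        (christoffelL H (φ x) (fderiv ℝ φ x w) (V x))) with hE
  have bE (v w : Coord m) : BoundedBy K N (E v w) :=
    (((((bDVv v).clm hK (kΓ.clm_apply (kD w))).add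
      (bV.clm hK (kΓ.clm_apply (kD2 v w)))).add
      (bV.clm hK ((kDΓ.clm_apply (kD v)).clm_apply (kD w)))).add
      ((bDVv w).clm hK (kΓ.clm_apply (kD v)))).add ((bΓV w).clm hK (kΓ.clm_apply (kD v)))
  set F : Coord m → Coord m → Coord m → Coord n := fun v w x =>
    fderiv ℝ V x (christoffelL G x v w)
      + christoffelL H (φ x) (fderiv ℝ φ x (christoffelL G x v w)) (V x) with hF
  have bF (v w : Coord m) : BoundedBy K N (F v w) :=
    (bDV.apply hK (kΓM v w)).add
      (bV.clm hK (kΓ.clm_apply ((cD.continuousOn.mono hKU).clm_apply (kΓM v w))))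
  set R : Coord m → Coord m → Coord m → Coord n := fun u w x =>
    (fderiv ℝ (christoffelL H) (φ x) (fderiv ℝ φ x u) (V x) (fderiv ℝ φ x w)
      + christoffelL H (φ x) (fderiv ℝ φ x u) (christoffelL H (φ x) (V x) (fderiv ℝ φ x w)))
    - (fderiv ℝ (christoffelL H) (φ x) (V x) (fderiv ℝ φ x u) (fderiv ℝ φ x w)
      + christoffelL H (φ x) (V x) (christoffelL H (φ x) (fderiv ℝ φ x u) (fderiv ℝ φ x w)))
    with hR
  have bR (u w : Coord m) : BoundedBy K N (R u w) :=
    (((bV.clm hK (kDΓ.clm_apply (kD u))).apply hK (kD w)).add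
      (((bV.clm hK kΓ).apply hK (kD w)).clm hK (kΓ.clm_apply (kD u)))).sub
    ((((bV.clm hK kDΓ).apply hK (kD u)).apply hK (kD w)).add
      ((bV.clm hK kΓ).apply hK ((kΓ.clm_apply (kD u)).clm_apply (kD w))))
  have kG (i j : Fin m) : ContinuousOn (fun x => inverseMetric G x i j) K :=
    (h.source.contDiffOn_inverseMetric i j).continuousOn.mono hKU
  have btot : BoundedBy K N fun x => ∑ i, ∑ j, inverseMetric G x i j •
      (R (coordVec i) (coordVec j) x - (E (coordVec i) (coordVec j) x
        - F (coordVec i) (coordVec j) x)) :=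
    BoundedBy.sum _ fun i => BoundedBy.sum _ fun j =>
      ((bR _ _).sub ((bE _ _).sub (bF _ _))).smul hK (kG i j)
  obtain ⟨C, hC⟩ := btot
  refine ⟨C, fun x hx => ?_⟩
  have hxU := hKU hx
  have key : ∑ i, ∑ j, inverseMetric G x i j •
        fderiv ℝ (fun z => fderiv ℝ V z (coordVec j)) x (coordVec i)
      = ∑ i, ∑ j, inverseMetric G x i j • (R (coordVec i) (coordVec j) x
        - (E (coordVec i) (coordVec j) x - F (coordVec i) (coordVec j) x)) := by
    have hb := hbi x hxU
    rw [bitension, roughLaplacian, ← metricTrace_sub, metricTrace] at hb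
    rw [← sub_eq_zero, ← hb]
    simp only [← Finset.sum_sub_distrib, ← smul_sub]
    refine Finset.sum_congr rfl fun i _ => Finset.sum_congr rfl fun j _ => ?_
    rw [← hV, covAlong_covAlong h.target (h.mapsTo hxU) (h.contDiffAt hxU)
      (hVs.contDiffAt (hUo.mem_nhds hxU)), h.target.curvature_eq (h.mapsTo hxU)]
    congr 1
    simp only [hR, hE, hF, covAlong, ← christoffelL_apply]
    abel
  rw [key]
  exact hC x hx

/-- Unique continuation for the tension field of a biharmonic isometric immersion. -/
theorem tension_eq_zero_on_ball (h : IsometricOn G U H O φ)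
    (hbi : ∀ x ∈ U, bitension G H φ x = 0) {q : Coord m} {r ρ R : ℝ} (hr : 0 < r) (hρ : 0 < ρ)
    (hR : ρ < R) (hball : Metric.closedBall q R ⊆ U)
    (hzero : ∀ x ∈ Metric.ball q r, tension G H φ x = 0) :
    ∀ x ∈ Metric.ball q ρ, tension G H φ x = 0 := by
  obtain ⟨C, hC⟩ := h.exists_bound_of_biharmonic hbi (isCompact_closedBall q R) hball
  obtain ⟨R₁, h1, h2⟩ := exists_between hR
  refine eq_zero_of_elliptic_inequality h.source.isOpen
    (a := fun i j x => inverseMetric G x i j) h.source.contDiffOn_inverseMetric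
    (fun i j x hx => (h.source.isInner x hx).inv_gram_symm i j)
    (fun x hx ξ hξ => (h.source.isInner x hx).inv_gram_pos hξ)
    (contDiffOn_tension h.source h.target h.mapsTo h.smooth) hr hρ h1 h2 hball (C := C)
    (fun x hx => hC x (Metric.ball_subset_closedBall (Metric.ball_subset_ball hR.le hx))) hzero

end IsometricOn

end BiharmonicUniqueContinuation

/-! ### Passage from manifolds to charts. -/

section Charts

open Filter Topology Bundle

variable {m n : ℕ} {M : Type*} [TopologicalSpace M] [ChartedSpace (Coord m) M]
  {c c' : OpenPartialHomeomorph M (Coord m)}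

theorem mdifferentiable_of_mem_maximalAtlas (hc : c ∈ IsManifold.maximalAtlas (𝓡 m) ∞ M) :
    c.MDifferentiable (𝓡 m) (𝓡 m) :=
  ⟨(contMDiffOn_of_mem_maximalAtlas hc).mdifferentiableOn (by simp),
    (contMDiffOn_symm_of_mem_maximalAtlas hc).mdifferentiableOn (by simp)⟩

variable [IsManifold (𝓡 m) ∞ M]
  {N : Type*} [TopologicalSpace N] [ChartedSpace (Coord n) N] [IsManifold (𝓡 n) ∞ N]
  {d d' : OpenPartialHomeomorph N (Coord n)}

/-- Coordinate vector fields are smooth sections: the tangent map of the parametrization is applied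
to a constant section. -/
theorem contMDiffOn_mfderiv_symm (hc : c ∈ IsManifold.maximalAtlas (𝓡 m) ∞ M) (v : Coord m) :
    ContMDiffOn (𝓡 m) (𝓡 m).tangent ∞
      (fun x => (TotalSpace.mk' (Coord m) (E := (TangentSpace (𝓡 m) : M → Type _)) (c.symm x)
        (mfderiv (𝓡 m) (𝓡 m) c.symm x v))) c.target := by
  have h1 := (contMDiffOn_symm_of_mem_maximalAtlas hc).contMDiffOn_tangentMapWithin
    (m := ∞) (by simp) c.open_target.uniqueMDiffOn
  have h2 : ContMDiffOn (𝓡 m) (𝓡 m).tangent ∞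
      (fun x : Coord m => (TotalSpace.mk' (Coord m)
        (E := (TangentSpace (𝓡 m) : Coord m → Type _)) x v)) c.target :=
    contMDiffOn_vectorSpace_iff_contDiffOn.2 contDiffOn_const
  refine (h1.comp h2 fun x hx => hx).congr fun x hx => ?_
  simp only [Function.comp_apply, tangentMapWithin]
  rw [mfderivWithin_of_isOpen c.open_target hx]

theorem contMDiffOn_inner_mfderiv_symm (g : RMetric m M)
    (hc : c ∈ IsManifold.maximalAtlas (𝓡 m) ∞ M) (v w : Coord m) :
    ContMDiffOn (𝓡 m) 𝓘(ℝ, ℝ) ∞ (fun x => g.inner (c.symm x)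
      (mfderiv (𝓡 m) (𝓡 m) c.symm x v) (mfderiv (𝓡 m) (𝓡 m) c.symm x w)) c.target := by
  intro x hx
  have hb := (contMDiffOn_symm_of_mem_maximalAtlas hc) x hx
  have h1 := ContMDiffAt.comp_contMDiffWithinAt x (g.contMDiff.contMDiffAt (x := c.symm x)) hb
  have h2 := ContMDiffWithinAt.clm_bundle_apply₂ (F₁ := Coord m) (F₂ := Coord m) (F₃ := ℝ)
    (E₃ := Bundle.Trivial M ℝ) (ψ := fun x => g.inner (c.symm x)) h1
    (contMDiffOn_mfderiv_symm hc v x hx) (contMDiffOn_mfderiv_symm hc w x hx)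
  rw [contMDiffWithinAt_totalSpace] at h2
  exact h2.2

theorem metricInChart_metricOn (g : RMetric m M) (hc : c ∈ IsManifold.maximalAtlas (𝓡 m) ∞ M) :
    MetricOn (metricInChart g c) c.target := by
  refine ⟨c.open_target, ?_, fun x hx => ⟨fun v w => ?_, fun v hv => ?_⟩⟩
  · rw [contDiffOn_clm_apply]
    intro v
    rw [contDiffOn_clm_apply]
    intro w
    exact contMDiffOn_iff_contDiffOn.1 (contMDiffOn_inner_mfderiv_symm g hc v w)
  · rw [metricInChart_apply, metricInChart_apply]
    exact g.symm _ _ _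
  · rw [metricInChart_apply]
    refine g.pos _ _ fun h0 => hv ?_
    exact (mdifferentiable_of_mem_maximalAtlas hc).symm.mfderiv_injective hx
      (h0.trans (map_zero _).symm)

/-- Combined with `IsIsometricImmersion.isometricOn` for two charts of the same manifold, this makes
transition maps isometries of the coordinate metrics. -/
theorem isIsometricImmersion_id (g : RMetric m M) : IsIsometricImmersion g g id where
  smooth := contMDiff_id
  isometric p v w := by rw [mfderiv_id]; rfl

theorem IsIsometricImmersion.isometricOn {g : RMetric m M} {h : RMetric n N} {φ : M → N}
    (hφ : IsIsometricImmersion g h φ) (hc : c ∈ IsManifold.maximalAtlas (𝓡 m) ∞ M)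
    (hd : d ∈ IsManifold.maximalAtlas (𝓡 n) ∞ N) :
    IsometricOn (metricInChart g c) (c.target ∩ c.symm ⁻¹' (φ ⁻¹' d.source))
      (metricInChart h d) d.target (fun z => d (φ (c.symm z))) := by
  have hopen : IsOpen (c.target ∩ c.symm ⁻¹' (φ ⁻¹' d.source)) :=
    c.symm.isOpen_inter_preimage (d.open_source.preimage hφ.smooth.continuous)
  have hcs := contMDiffOn_symm_of_mem_maximalAtlas hc
  have hsm : ContMDiffOn (𝓡 m) (𝓡 n) ∞ (fun z => d (φ (c.symm z)))
      (c.target ∩ c.symm ⁻¹' (φ ⁻¹' d.source)) :=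
    (contMDiffOn_of_mem_maximalAtlas hd).comp
      (hφ.smooth.comp_contMDiffOn (hcs.mono Set.inter_subset_left)) fun x hx => hx.2
  have hG := metricInChart_metricOn g hc
  refine ⟨⟨hopen, hG.smooth.mono Set.inter_subset_left, fun x hx => hG.isInner x hx.1⟩,
    metricInChart_metricOn h hd, fun x hx => d.map_source hx.2, contMDiffOn_iff_contDiffOn.1 hsm,
    fun x hx v w => ?_⟩
  have hD : ∀ v : Coord m, mfderiv (𝓡 n) (𝓡 n) d.symm (d (φ (c.symm x)))
      (fderiv ℝ (fun z => d (φ (c.symm z))) x v)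
      = mfderiv (𝓡 m) (𝓡 n) φ (c.symm x) (mfderiv (𝓡 m) (𝓡 m) c.symm x v) := by
    intro v
    have e1 : HasMFDerivAt (𝓡 m) (𝓡 n) (fun z => d (φ (c.symm z))) x
        (mfderiv (𝓡 m) (𝓡 n) (fun z => d (φ (c.symm z))) x) :=
      ((hsm.contMDiffAt (hopen.mem_nhds hx)).mdifferentiableAt (by simp)).hasMFDerivAt
    have e2 := ((mdifferentiable_of_mem_maximalAtlas hd).symm.mdifferentiableAt
      (d.map_source hx.2)).hasMFDerivAt.comp x e1
    have e3 := ((hφ.smooth.contMDiffAt (x := c.symm x)).mdifferentiableAt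
      (by simp)).hasMFDerivAt.comp x
        ((mdifferentiable_of_mem_maximalAtlas hc).mdifferentiableAt_symm hx.1).hasMFDerivAt
    have hev : (φ ∘ c.symm) =ᶠ[𝓝 x] d.symm ∘ fun z => d (φ (c.symm z)) := by
      filter_upwards [hopen.mem_nhds hx] with y hy
      exact (d.left_inv hy.2).symm
    have e4 := hasMFDerivAt_unique (e2.congr_of_eventuallyEq hev) e3
    rw [mfderiv_eq_fderiv] at e4
    exact congrArg (fun L => L v) e4
  -- The points `d.symm (d y)` and `y` are equal only propositionally, so the metric is transported
  -- between them with both tangent spaces viewed as `Coord n`.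
  have hbase : ∀ {p q : N} (_ : p = q) (a b : Coord n),
      (h.inner p : Coord n →L[ℝ] Coord n →L[ℝ] ℝ) a b
        = (h.inner q : Coord n →L[ℝ] Coord n →L[ℝ] ℝ) a b := by
    rintro p _ rfl a b
    rfl
  rw [metricInChart_apply, metricInChart_apply, ← hφ.isometric (c.symm x)]
  refine (hbase (d.left_inv hx.2) _ _).trans ?_
  exact congrArg₂ (fun a b : Coord n =>
    (h.inner (φ (c.symm x)) : Coord n →L[ℝ] Coord n →L[ℝ] ℝ) a b) (hD v) (hD w)

end Charts

/-! ### Globalization on the connected manifold and conclusion. -/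

section Manifolds

open Filter Topology

variable {m n : ℕ}
  {M : Type*} [TopologicalSpace M] [ChartedSpace (Coord m) M] [IsManifold (𝓡 m) ∞ M]
  {N : Type*} [TopologicalSpace N] [ChartedSpace (Coord n) N] [IsManifold (𝓡 n) ∞ N]
  {g : RMetric m M} {h : RMetric n N} {φ : M → N}

/-- The tension field of `φ` with respect to charts `c` and `d`. -/
def tensionInCharts (g : RMetric m M) (h : RMetric n N) (φ : M → N)
    (c : OpenPartialHomeomorph M (Coord m)) (d : OpenPartialHomeomorph N (Coord n)) :
    Coord m → Coord n :=
  tension (metricInChart g c) (metricInChart h d) fun z => d (φ (c.symm z))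

/-- The two coordinate expressions of the tension field correspond under the differential of the
transition map of `N`, which is injective. -/
theorem IsIsometricImmersion.tensionInCharts_eq_zero (hφ : IsIsometricImmersion g h φ)
    {c c' : OpenPartialHomeomorph M (Coord m)} {d d' : OpenPartialHomeomorph N (Coord n)}
    (hc : c ∈ IsManifold.maximalAtlas (𝓡 m) ∞ M) (hc' : c' ∈ IsManifold.maximalAtlas (𝓡 m) ∞ M)
    (hd : d ∈ IsManifold.maximalAtlas (𝓡 n) ∞ N) (hd' : d' ∈ IsManifold.maximalAtlas (𝓡 n) ∞ N)
    {p : M} (hpc : p ∈ c.source) (hpc' : p ∈ c'.source) (hpd : φ p ∈ d.source)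
    (hpd' : φ p ∈ d'.source) (h0 : tensionInCharts g h φ c d (c p) = 0) :
    tensionInCharts g h φ c' d' (c' p) = 0 := by
  have hψ := (isIsometricImmersion_id g).isometricOn hc' hc
  have hθ := (isIsometricImmersion_id h).isometricOn hd' hd
  have h1 := hφ.isometricOn hc hd
  have h2 := hφ.isometricOn hc' hd'
  have hx : c' p ∈ c'.target ∩ c'.symm ⁻¹' (id ⁻¹' c.source) :=
    ⟨c'.map_source hpc', by simpa [c'.left_inv hpc'] using hpc⟩
  have hx2 : c' p ∈ c'.target ∩ c'.symm ⁻¹' (φ ⁻¹' d'.source) :=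
    ⟨c'.map_source hpc', by simpa [c'.left_inv hpc'] using hpd'⟩
  have hx1 : c p ∈ c.target ∩ c.symm ⁻¹' (φ ⁻¹' d.source) :=
    ⟨c.map_source hpc, by simpa [c.left_inv hpc] using hpd⟩
  have hy : d' (φ (c'.symm (c' p))) ∈ d'.target ∩ d'.symm ⁻¹' (id ⁻¹' d.source) := by
    rw [c'.left_inv hpc']
    exact ⟨d'.map_source hpd', by simpa [d'.left_inv hpd'] using hpd⟩
  have hψp : c (id (c'.symm (c' p))) = c p := by rw [c'.left_inv hpc', id]
  have key := hψ.fderiv_tension hθ (φ' := fun z => d' (φ (c'.symm z)))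
    (φ := fun z => d (φ (c.symm z))) hx (h2.contDiffAt hx2) (by rw [hψp]; exact h1.contDiffAt hx1)
    hy (by
      filter_upwards [hψ.source.isOpen.mem_nhds hx, h2.source.isOpen.mem_nhds hx2] with z hz hz2
      simp only [id]
      have hz' : c'.symm z ∈ c.source := hz.2
      rw [d'.left_inv hz2.2, c.left_inv hz'])
  rw [hψp] at key
  exact hθ.injective_fderiv hy ((key.trans h0).trans (map_zero _).symm)

/-- The points at which the tension field vanishes. -/
def tensionZeroSet (g : RMetric m M) (h : RMetric n N) (φ : M → N) : Set M :=
  {p | ∀ c ∈ IsManifold.maximalAtlas (𝓡 m) ∞ M, ∀ d ∈ IsManifold.maximalAtlas (𝓡 n) ∞ N,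
    p ∈ c.source → φ p ∈ d.source → tensionInCharts g h φ c d (c p) = 0}

theorem IsIsometricImmersion.mem_interior_tensionZeroSet (hφ : IsIsometricImmersion g h φ)
    {c : OpenPartialHomeomorph M (Coord m)} {d : OpenPartialHomeomorph N (Coord n)}
    (hc : c ∈ IsManifold.maximalAtlas (𝓡 m) ∞ M) (hd : d ∈ IsManifold.maximalAtlas (𝓡 n) ∞ N)
    {p : M} (hpc : p ∈ c.source) (hpd : φ p ∈ d.source)
    (h0 : ∀ᶠ x in 𝓝 (c p), tensionInCharts g h φ c d x = 0) :
    p ∈ interior (tensionZeroSet g h φ) := by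
  rw [mem_interior_iff_mem_nhds]
  filter_upwards [(c.continuousAt hpc).eventually h0, c.open_source.mem_nhds hpc,
    (d.open_source.preimage hφ.smooth.continuous).mem_nhds hpd] with q hq hqc hqd c' hc' d' hd'
    hqc' hqd'
  exact hφ.tensionInCharts_eq_zero hc hc' hd hd' hqc hqc' hqd hqd' hq

/-- For closedness, a boundary point `p` has points `q` of the interior arbitrarily near. Unique
continuation spreads the vanishing from a small ball around `q` to a ball containing a neighbourhood
of `p`. -/
theorem isClopen_interior_tensionZeroSet (hφ : IsIsometricImmersion g h φ)
    (hbi : IsBiharmonic g h φ) : IsClopen (interior (tensionZeroSet g h φ)) := by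
  refine ⟨isClosed_of_closure_subset fun p hp => ?_, isOpen_interior⟩
  set c := chartAt (Coord m) p
  set d := chartAt (Coord n) (φ p)
  have hc : c ∈ IsManifold.maximalAtlas (𝓡 m) ∞ M := IsManifold.chart_mem_maximalAtlas p
  have hd : d ∈ IsManifold.maximalAtlas (𝓡 n) ∞ N := IsManifold.chart_mem_maximalAtlas (φ p)
  have hpc : p ∈ c.source := mem_chart_source _ p
  have hpd : φ p ∈ d.source := mem_chart_source _ (φ p)
  have hI := hφ.isometricOn hc hd
  set U := c.target ∩ c.symm ⁻¹' (φ ⁻¹' d.source)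
  have hpU : c p ∈ U := ⟨c.map_source hpc, by simpa [c.left_inv hpc] using hpd⟩
  obtain ⟨ε, hε, hball⟩ := Metric.isOpen_iff.1 hI.source.isOpen _ hpU
  have hnear : c.source ∩ c ⁻¹' Metric.ball (c p) (ε / 4) ∈ 𝓝 p :=
    inter_mem (c.open_source.mem_nhds hpc)
      ((c.continuousAt hpc).preimage_mem_nhds (Metric.ball_mem_nhds _ (by positivity)))
  obtain ⟨q, ⟨hqc, hqb⟩, hqZ⟩ := mem_closure_iff_nhds.1 hp _ hnear
  have hqb' : dist (c q) (c p) < ε / 4 := hqb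
  have hqU : c q ∈ U := hball (Metric.ball_subset_ball (by linarith) hqb)
  have hq0 : ∀ᶠ x in 𝓝 (c q), tensionInCharts g h φ c d x = 0 := by
    have h1 : ∀ᶠ x in 𝓝 (c q), c.symm x ∈ tensionZeroSet g h φ := by
      refine (c.continuousAt_symm hqU.1).eventually ?_
      rw [c.left_inv hqc]
      exact mem_interior_iff_mem_nhds.1 hqZ
    filter_upwards [h1, hI.source.isOpen.mem_nhds hqU] with x hx hxU
    have := hx c hc d hd (c.map_target hxU.1) hxU.2
    rwa [c.right_inv hxU.1] at this
  obtain ⟨r, hr, hr0⟩ := Metric.eventually_nhds_iff_ball.1 hq0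
  -- The centre `q` is within `ε/4` of `p` in the chart: radius `ε/2` about `q` covers the `ε/4`
  -- ball about `p`, and radius `5ε/8` about `q` stays inside the `ε` ball about `p`.
  have hmain := hI.tension_eq_zero_on_ball (fun x hx => hbi c hc d hd x hx.1 hx.2) hr
    (ρ := ε / 2) (R := 5 * ε / 8) (by positivity) (by linarith)
    (fun x hx => hball (by
      have h1 : dist x (c q) ≤ 5 * ε / 8 := hx
      have h2 := dist_triangle x (c q) (c p)
      rw [Metric.mem_ball]
      linarith)) hr0
  refine hφ.mem_interior_tensionZeroSet hc hd hpc hpd ?_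
  filter_upwards [Metric.ball_mem_nhds (c p) (by positivity : 0 < ε / 4)] with x hx
  refine hmain x ?_
  have h1 : dist x (c p) < ε / 4 := hx
  have h2 := dist_triangle_right x (c q) (c p)
  rw [Metric.mem_ball]
  linarith

theorem isMinimal_of_tensionZeroSet_eq_univ (hφ : IsIsometricImmersion g h φ)
    (hZ : tensionZeroSet g h φ = Set.univ) : IsMinimal g h φ := by
  intro c hc d hd x hx hxd
  have h0 : c.symm x ∈ tensionZeroSet g h φ := hZ ▸ Set.mem_univ _
  have h1 := h0 c hc d hd (c.map_target hx) hxd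
  rw [c.right_inv hx] at h1
  rw [(hφ.isometricOn hc hd).meanCurvature_eq ⟨hx, hxd⟩,
    show tension (metricInChart g c) (metricInChart h d) (fun z => d (φ (c.symm z))) x = 0 from h1,
    smul_zero]

theorem exists_eq_const_of_fderiv_eq_zero [ConnectedSpace M] {f : M → ℝ}
    (hf : ContMDiff (𝓡 m) 𝓘(ℝ, ℝ) ∞ f)
    (h0 : ∀ c ∈ IsManifold.maximalAtlas (𝓡 m) ∞ M, ∀ x ∈ c.target,
      fderiv ℝ (fun z => f (c.symm z)) x = 0) : ∃ C : ℝ, ∀ p : M, f p = C := by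
  have hloc : IsLocallyConstant f := by
    rw [IsLocallyConstant.iff_eventually_eq]
    intro p
    have hc : chartAt (Coord m) p ∈ IsManifold.maximalAtlas (𝓡 m) ∞ M :=
      IsManifold.chart_mem_maximalAtlas p
    set c := chartAt (Coord m) p
    have hpc : p ∈ c.source := mem_chart_source _ p
    have hfc : ContDiffOn ℝ ∞ (fun z => f (c.symm z)) c.target :=
      contMDiffOn_iff_contDiffOn.1 (hf.comp_contMDiffOn (contMDiffOn_symm_of_mem_maximalAtlas hc))
    obtain ⟨ε, hε, hball⟩ := Metric.isOpen_iff.1 c.open_target _ (c.map_source hpc)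
    filter_upwards [c.open_source.mem_nhds hpc,
      (c.continuousAt hpc).preimage_mem_nhds (Metric.ball_mem_nhds _ hε)] with q hqc hq
    have := Metric.isOpen_ball.is_const_of_fderiv_eq_zero (𝕜 := ℝ)
      (convex_ball (c p) ε).isPreconnected
      ((hfc.mono hball).differentiableOn (by simp)) (fun x hx => h0 c hc x (hball hx)) hq
      (Metric.mem_ball_self hε)
    simpa only [c.left_inv hqc, c.left_inv hpc] using this
  obtain ⟨C, hC⟩ := hloc.exists_eq_const
  exact ⟨C, fun p => congrFun hC p⟩

/-- A nonzero `df` persists nearby by continuity and forces `τ = 0` on an open set. The clopen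
interior of the zero set is then nonempty, hence all of `M`, against properness. -/
theorem IsFBiharmonic.fderiv_eq_zero [ConnectedSpace M] (hφ : IsIsometricImmersion g h φ)
    (humb : IsPseudoUmbilical g h φ) (hbi : IsBiharmonic g h φ) (hproper : ¬ IsMinimal g h φ)
    {f : M → ℝ} (hf : IsFBiharmonic g h φ f) {c : OpenPartialHomeomorph M (Coord m)}
    (hc : c ∈ IsManifold.maximalAtlas (𝓡 m) ∞ M) {x : Coord m} (hx : x ∈ c.target) :
    fderiv ℝ (fun z => f (c.symm z)) x = 0 := by
  by_contra hne
  have hd : chartAt (Coord n) (φ (c.symm x)) ∈ IsManifold.maximalAtlas (𝓡 n) ∞ N :=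
    IsManifold.chart_mem_maximalAtlas _
  set d := chartAt (Coord n) (φ (c.symm x))
  have hxd : φ (c.symm x) ∈ d.source := mem_chart_source _ _
  have hI := hφ.isometricOn hc hd
  have hfc : ContDiffOn ℝ ∞ (fun z => f (c.symm z)) c.target :=
    contMDiffOn_iff_contDiffOn.1
      (hf.smooth.comp_contMDiffOn (contMDiffOn_symm_of_mem_maximalAtlas hc))
  have hcont : ContinuousAt (fderiv ℝ fun z => f (c.symm z)) x :=
    ((hfc.fderiv_of_isOpen c.open_target (m := ∞) (by simp)).continuousOn).continuousAt
      (c.open_target.mem_nhds hx)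
  have h0 : ∀ᶠ y in 𝓝 x, tensionInCharts g h φ c d y = 0 := by
    filter_upwards [hcont.eventually_ne hne, hI.source.isOpen.mem_nhds ⟨hx, hxd⟩] with y hy hyU
    exact (hI.fderiv_eq_zero_or_tension_eq_zero hyU (humb c hc d hd y hyU.1 hyU.2)
      (hbi c hc d hd y hyU.1 hyU.2) (hf.equation c hc d hd y hyU.1 hyU.2)).resolve_left hy
  have hp : c.symm x ∈ interior (tensionZeroSet g h φ) :=
    hφ.mem_interior_tensionZeroSet hc hd (c.map_target hx) hxd (by rwa [c.right_inv hx])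
  have huniv := (isClopen_interior_tensionZeroSet hφ hbi).eq_univ ⟨_, hp⟩
  exact hproper (isMinimal_of_tensionZeroSet_eq_univ hφ (interior_eq_univ.1 huniv))

end Manifolds

end FBiharm

end

theorem theorem2p4 {m n : ℕ}
    {M : Type*} [TopologicalSpace M] [ChartedSpace (EuclideanSpace ℝ (Fin m)) M]
    [IsManifold (𝓡 m) ∞ M] [T2Space M] [SecondCountableTopology M] [ConnectedSpace M]
    {N : Type*} [TopologicalSpace N] [ChartedSpace (EuclideanSpace ℝ (Fin n)) N]
    [IsManifold (𝓡 n) ∞ N] [T2Space N] [SecondCountableTopology N]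
    (g : FBiharm.RMetric m M) (h : FBiharm.RMetric n N) (φ : M → N)
    (hφ : FBiharm.IsIsometricImmersion g h φ)
    (humb : FBiharm.IsPseudoUmbilical g h φ)
    (hbi : FBiharm.IsBiharmonic g h φ)
    (hproper : ¬ FBiharm.IsMinimal g h φ)
    (f : M → ℝ) (hf : FBiharm.IsFBiharmonic g h φ f) :
    ∃ C : ℝ, ∀ p : M, f p = C := by
  exact FBiharm.exists_eq_const_of_fderiv_eq_zero hf.smooth fun c hc x hx =>
    hf.fderiv_eq_zero hφ humb hbi hproper hc hx
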